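/- All manifolds are smooth, finite-dimensional, without boundary, Hausdorff and second countable (σ-compact). On a manifold $M$ let $\mathbb{T}M = TM\oplus T^*M$, with the symmetric pairing $\langle X+\alpha, Y+\beta\rangle_+ = \tfrac12(\beta(X)+\alpha(Y))$ and the Courant bracket $$[\![X+\alpha, Y+\beta]\!] = [X,Y] + \mathcal{L}_X\beta - \mathcal{L}_Y\alpha + \tfrac12\, d(\alpha(Y)-\beta(X)).$$ A Dirac structure on $M$ is a smooth subbundle $L\subset\mathbb{T}M$ that is (fibrewise) maximally isotropic for $\langle\cdot,\cdot\rangle_+$ and whose space of smooth sections $\Gamma(L)$ is closed under the Courant bracket; $L$ carries the anchor and the bracket induced by $\mathbb{T}M$, that is, the projection to $TM$ and the restricted Courant bracket. Let $\varphi: M\to N$ be a smooth submersion (every differential $\varphi_*:T_xM\to T_{\varphi(x)}N$ is surjective) and let $K$ be a Dirac structure on $N$. For a Dirac structure $L$ on $M$ put, for $x\in M$, $$\mathcal{B}_\varphi(K)_x=\{X+\varphi^*\alpha\in \mathbb{T}_xM : \varphi_*X+\alpha\in K_{\varphi(x)}\},\qquad \mathcal{F}_\varphi(L)_x=\{\varphi_*X+\alpha\in\mathbb{T}_{\varphi(x)}N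 : X+\varphi^*\alpha\in L_x\}.$$ The map $\varphi:(M,L)\to(N,K)$ is a b-Dirac map if $L_x=\mathcal{B}_\varphi(K)_x$ for all $x\in M$, and an f-Dirac map if $K_{\varphi(x)}=\mathcal{F}_\varphi(L)_x$ for all $x\in M$. Let $$\varphi^{!!}K=\{(X,v)\in T_xM\times K_{\varphi(x)} : \rho(v)=\varphi_*X,\ x\in M\},$$ where $\rho:\mathbb{T}N\to TN$ is the projection, with anchor $(X,v)\mapsto X$ and with the bracket on smooth sections determined by $$\Big[\Big(X,\sum_i f_i\otimes\alpha_i\Big),\Big(Y,\sum_j g_j\otimes\beta_j\Big)\Big]=\Big([X,Y],\ \sum_{i,j} f_ig_j\otimes[\![\alpha_i,\beta_j]\!]+\sum_j X(g_j)\otimes\beta_j-\sum_i Y(f_i)\otimes\alpha_i\Big)$$ at every point near which the two sections are given by such finite sums, $f_i,g_j\in C^\infty(M)$, $\alpha_i,\beta_j\in\Gamma(K)$. Then the following hold. 1. There is exactly one bracket on $\Gamma(\varphi^{!!}K)$ as above, and with it $\varphi^{!!}K$ is a Lie algebroid over $M$ (the pullback Lie algebroid). 2. $\mathcal{B}_\varphi(K)$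 is a smooth subbundle of $\mathbb{T}M$, its smooth sections are closed under the Courant bracket, and with the anchor and bracket induced by $\mathbb{T}M$ it is a Lie algebroid. The map $$\Psi:\mathcal{B}_\varphi(K)\to\varphi^{!!}K,\qquad X+\varphi^*\beta\mapsto (X,\varphi_*X+\beta),$$ is well defined and is an isomorphism of Lie algebroids over the identity of $M$: a smooth isomorphism of vector bundles that preserves anchors and brackets. 3. If $L$ is a Dirac structure on $M$ for which $\varphi:(M,L)\to(N,K)$ is a b-Dirac map, then $\varphi:(M,L)\to(N,K)$ is also an f-Dirac map, and $L$, with the anchor and bracket induced by $\mathbb{T}M$, is a Lie algebroid isomorphic to $\varphi^{!!}K$ over the identity of $M$. -/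

import Mathlib

open Bundle Set Filter
open scoped Manifold ContDiff Topology

noncomputable section

/-!
Manifolds are finite-dimensional, without boundary, modelled on a normed space `E` through
`𝓘(ℝ, E)`.  Vector bundles are given by a family of fibres `V x` with model fibre `F`; smooth
sections are dependent functions `s : Π x, V x` for which `x ↦ ⟨x, s x⟩` is a smooth map into the
total space.
-/

section Algebroid

variable {E : Type*} [NormedAddCommGroup E] [NormedSpace ℝ E]
  {M : Type*} [TopologicalSpace M] [ChartedSpace E M] [IsManifold 𝓘(ℝ, E) ∞ M]
  {F : Type*} [NormedAddCommGroup F] [NormedSpace ℝ F]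
  {V : M → Type*} [TopologicalSpace (TotalSpace F V)]
  [∀ x, AddCommGroup (V x)] [∀ x, Module ℝ (V x)] [∀ x, TopologicalSpace (V x)]
  [FiberBundle F V]

variable (E F) in
/-- A family of subspaces `A x ⊆ V x` is a smooth subbundle of `V` if around every point it has a
smooth local frame. -/
def IsSmoothSubbundle (A : ∀ x, Submodule ℝ (V x)) : Prop :=
  ∀ x₀ : M, ∃ U : Set M, IsOpen U ∧ x₀ ∈ U ∧ ∃ (r : ℕ) (s : Fin r → ∀ x, V x),
    (∀ i, ContMDiffOn 𝓘(ℝ, E) (𝓘(ℝ, E).prod 𝓘(ℝ, F)) ∞ (fun x => TotalSpace.mk' F x (s i x)) U) ∧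
    ∀ x ∈ U, LinearIndependent ℝ (fun i => s i x) ∧
      Submodule.span ℝ (Set.range fun i => s i x) = A x

variable [VectorBundle ℝ F V]

variable (E F) in
/-- The space `Γ(A)` of (global) smooth sections of a family of subspaces `A x ⊆ V x`. -/
def SmoothSections (A : ∀ x, Submodule ℝ (V x)) : Submodule ℝ (∀ x, A x) where
  carrier := {s | ContMDiff 𝓘(ℝ, E) (𝓘(ℝ, E).prod 𝓘(ℝ, F)) ∞
    (fun x => TotalSpace.mk' F x (s x : V x))}
  add_mem' hs ht := ContMDiff.add_section hs ht
  zero_mem' := contMDiff_zeroSection ℝ V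
  smul_mem' _ _ hs := ContMDiff.const_smul_section hs

variable (E F) in
/-- The data of an anchor and of a bracket on sections for a family of subspaces `A x ⊆ V x`. -/
@[ext]
structure AlgebroidData (A : ∀ x, Submodule ℝ (V x)) where
  anchor : ∀ x, A x →ₗ[ℝ] TangentSpace 𝓘(ℝ, E) x
  bracket : SmoothSections E F A → SmoothSections E F A → SmoothSections E F A

/-- The derivative `X(f)` of a function `f` at `x` along a tangent vector `X` at `x`. -/
def dirDeriv (f : M → ℝ) (x : M) (X : TangentSpace 𝓘(ℝ, E) x) : ℝ :=
  mfderiv 𝓘(ℝ, E) 𝓘(ℝ, ℝ) f x X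

/-- `A`, with the given anchor and bracket, is a Lie algebroid: `A` is a smooth vector bundle, the
anchor is a smooth bundle map to the tangent bundle, the bracket is a Lie bracket on `Γ(A)`, and
`[s, f t] = f [s, t] + (a(s) f) t` for all smooth functions `f`. -/
structure IsLieAlgebroid {A : ∀ x, Submodule ℝ (V x)} (D : AlgebroidData E F A) : Prop where
  subbundle : IsSmoothSubbundle E F A
  anchor_smooth : ∀ s : SmoothSections E F A,
    ContMDiff 𝓘(ℝ, E) (𝓘(ℝ, E).prod 𝓘(ℝ, E)) ∞
      (fun x => TotalSpace.mk' E (E := fun x : M => TangentSpace 𝓘(ℝ, E) x) x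
        (D.anchor x (s.1 x)))
  bracket_add : ∀ s t u, D.bracket s (t + u) = D.bracket s t + D.bracket s u
  bracket_smul : ∀ (c : ℝ) s t, D.bracket s (c • t) = c • D.bracket s t
  bracket_skew : ∀ s t, D.bracket s t = - D.bracket t s
  jacobi : ∀ s t u, D.bracket s (D.bracket t u) =
    D.bracket (D.bracket s t) u + D.bracket t (D.bracket s u)
  leibniz : ∀ (f : M → ℝ), ContMDiff 𝓘(ℝ, E) 𝓘(ℝ, ℝ) ∞ f →
    ∀ s t ft : SmoothSections E F A, (∀ x, ft.1 x = f x • t.1 x) →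
      ∀ x, (D.bracket s ft).1 x =
        f x • (D.bracket s t).1 x + dirDeriv f x (D.anchor x (s.1 x)) • t.1 x

variable {F' : Type*} [NormedAddCommGroup F'] [NormedSpace ℝ F']
  {V' : M → Type*} [TopologicalSpace (TotalSpace F' V')]
  [∀ x, AddCommGroup (V' x)] [∀ x, Module ℝ (V' x)] [∀ x, TopologicalSpace (V' x)]
  [FiberBundle F' V'] [VectorBundle ℝ F' V']

/-- A family of fibrewise linear isomorphisms `ψ x : A x → B x` is an isomorphism of Lie algebroids
over the identity: it is an isomorphism of smooth vector bundles (it and its inverse carry smooth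
sections to smooth sections) and it preserves anchors and brackets. -/
structure IsLieAlgebroidIso {A : ∀ x, Submodule ℝ (V x)} {B : ∀ x, Submodule ℝ (V' x)}
    (D : AlgebroidData E F A) (D' : AlgebroidData E F' B) (ψ : ∀ x, A x ≃ₗ[ℝ] B x) : Prop where
  smooth : ∀ s : ∀ x, A x,
    s ∈ SmoothSections E F A ↔ (fun x => ψ x (s x)) ∈ SmoothSections E F' B
  anchor : ∀ x (v : A x), D'.anchor x (ψ x v) = D.anchor x v
  bracket : ∀ (s t : SmoothSections E F A) (s' t' : SmoothSections E F' B),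
    (∀ x, s'.1 x = ψ x (s.1 x)) → (∀ x, t'.1 x = ψ x (t.1 x)) →
      ∀ x, (D'.bracket s' t').1 x = ψ x ((D.bracket s t).1 x)

end Algebroid

/-- The fibres of a pullback bundle are additive groups (extending Mathlib's monoid instance). -/
instance pullbackFiberAddCommGroup {B B' : Type*} (f : B' → B) (W : B → Type*)
    [i : ∀ y, AddCommGroup (W y)] (x : B') : AddCommGroup ((f *ᵖ W) x) :=
  { (inferInstance : AddCommMonoid ((f *ᵖ W) x)) with
    neg := (i (f x)).neg
    sub := (i (f x)).sub
    sub_eq_add_neg := (i (f x)).sub_eq_add_neg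
    zsmul := (i (f x)).zsmul
    zsmul_zero' := (i (f x)).zsmul_zero'
    zsmul_succ' := (i (f x)).zsmul_succ'
    zsmul_neg' := (i (f x)).zsmul_neg'
    neg_add_cancel := (i (f x)).neg_add_cancel }

section Pullback

variable {E : Type*} [NormedAddCommGroup E] [NormedSpace ℝ E]
  {M : Type*} [TopologicalSpace M] [ChartedSpace E M] [IsManifold 𝓘(ℝ, E) ∞ M]
  {E' : Type*} [NormedAddCommGroup E'] [NormedSpace ℝ E']
  {N : Type*} [TopologicalSpace N] [ChartedSpace E' N]
  {F : Type*} [NormedAddCommGroup F] [NormedSpace ℝ F]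
  {V : N → Type*} [TopologicalSpace (TotalSpace F V)]
  [∀ x, AddCommGroup (V x)] [∀ x, Module ℝ (V x)] [∀ x, TopologicalSpace (V x)]
  [FiberBundle F V] [VectorBundle ℝ F V]

/-- The ambient bundle `TM ⊕ φ^! V` over `M`, where `φ^! V` is the pullback vector bundle. -/
abbrev PullbackAmbient (φ : C^∞⟮𝓘(ℝ, E), M; 𝓘(ℝ, E'), N⟯) (V : N → Type*) : M → Type _ :=
  (TangentSpace 𝓘(ℝ, E) : M → Type _) ×ᵇ (φ *ᵖ V)

/-- The fibres `{(X, v) ∈ T_x M × A_{φ(x)} : a(v) = φ_* X}` of the bundle `φ^{!!} A`. -/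
def pullbackFiber (φ : C^∞⟮𝓘(ℝ, E), M; 𝓘(ℝ, E'), N⟯) {A : ∀ y, Submodule ℝ (V y)}
    (D : AlgebroidData E' F A) (x : M) : Submodule ℝ (PullbackAmbient φ V x) where
  carrier := {p | ∃ v : A (φ x), (v : V (φ x)) = p.2 ∧
    D.anchor (φ x) v = mfderiv 𝓘(ℝ, E) 𝓘(ℝ, E') φ x p.1}
  add_mem' := by
    rintro p q ⟨v, hv, hv'⟩ ⟨w, hw, hw'⟩
    exact ⟨v + w, congrArg₂ (· + ·) hv hw, by simp [hv', hw']⟩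
  zero_mem' := ⟨0, rfl, by simp⟩
  smul_mem' := by
    rintro c p ⟨v, hv, hv'⟩
    exact ⟨c • v, congrArg (c • ·) hv, by simp [hv']⟩

/-- `P` is the pullback Lie algebroid structure on `φ^{!!} A`: the anchor is the projection to the
first factor, and, wherever two smooth sections can be written as `(X, ∑ i, f i ⊗ α i)` and
`(Y, ∑ j, g j ⊗ β j)` with `f i, g j ∈ C^∞(M)` and `α i, β j ∈ Γ(A)`, their bracket is
`([X, Y], ∑ i j, f i g j ⊗ [α i, β j] + ∑ j, X(g j) ⊗ β j - ∑ i, Y(f i) ⊗ α i)`. -/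
structure IsPullbackAlgebroid (φ : C^∞⟮𝓘(ℝ, E), M; 𝓘(ℝ, E'), N⟯) {A : ∀ y, Submodule ℝ (V y)}
    (D : AlgebroidData E' F A) (P : AlgebroidData E (E × F) (pullbackFiber φ D)) : Prop where
  anchor : ∀ x (p : pullbackFiber φ D x), P.anchor x p = p.1.1
  bracket : ∀ (s t : SmoothSections E (E × F) (pullbackFiber φ D)) (k l : ℕ)
    (f : Fin k → M → ℝ) (α : Fin k → SmoothSections E' F A)
    (g : Fin l → M → ℝ) (β : Fin l → SmoothSections E' F A),
    (∀ i, ContMDiff 𝓘(ℝ, E) 𝓘(ℝ, ℝ) ∞ (f i)) → (∀ j, ContMDiff 𝓘(ℝ, E) 𝓘(ℝ, ℝ) ∞ (g j)) →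
    ∀ x : M,
    (∀ᶠ y in 𝓝 x, (s.1 y).1.2 = ∑ i, f i y • ((α i).1 (φ y) : V (φ y))) →
    (∀ᶠ y in 𝓝 x, (t.1 y).1.2 = ∑ j, g j y • ((β j).1 (φ y) : V (φ y))) →
    ((P.bracket s t).1 x).1.1 =
        VectorField.mlieBracket 𝓘(ℝ, E) (fun y => (s.1 y).1.1) (fun y => (t.1 y).1.1) x ∧
    ((P.bracket s t).1 x).1.2 =
        ∑ i, ∑ j, (f i x * g j x) • ((D.bracket (α i) (β j)).1 (φ x) : V (φ x))
        + ∑ j, dirDeriv (g j) x (s.1 x).1.1 • ((β j).1 (φ x) : V (φ x))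
        - ∑ i, dirDeriv (f i) x (t.1 x).1.1 • ((α i).1 (φ x) : V (φ x))

end Pullback

section Dirac

variable (E : Type*) [NormedAddCommGroup E] [NormedSpace ℝ E]
  {M : Type*} [TopologicalSpace M] [ChartedSpace E M]

/-- The cotangent bundle `T^* M`. -/
abbrev Cotangent : M → Type _ := fun x => TangentSpace 𝓘(ℝ, E) x →L[ℝ] Trivial M ℝ x

/-- The generalized tangent bundle `𝕋 M = TM ⊕ T^* M`, with model fibre `E × (E →L[ℝ] ℝ)`. -/
abbrev GenTangent : M → Type _ := (TangentSpace 𝓘(ℝ, E) : M → Type _) ×ᵇ (Cotangent E)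

variable {E}

/-- The expression of a 1-form in the preferred chart at `x₀`, as a 1-form on the model space. -/
def oneFormInChart (β : ∀ x : M, Cotangent E x) (x₀ : M) (y : E) : E →L[ℝ] ℝ :=
  (β ((extChartAt 𝓘(ℝ, E) x₀).symm y)).comp
    (mfderiv 𝓘(ℝ, E) 𝓘(ℝ, E) (extChartAt 𝓘(ℝ, E) x₀).symm y)

/-- The value `dβ(u, v)` at `x` of the exterior derivative of a 1-form `β`, computed in the
preferred chart at `x`: there `dβ(u, v) = (D_u β)(v) - (D_v β)(u)`. -/
def oneFormDeriv (β : ∀ x : M, Cotangent E x) (x : M) :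
    TangentSpace 𝓘(ℝ, E) x →L[ℝ] TangentSpace 𝓘(ℝ, E) x →L[ℝ] ℝ :=
  let B : E →L[ℝ] E →L[ℝ] ℝ := fderiv ℝ (oneFormInChart β x) (extChartAt 𝓘(ℝ, E) x x)
  let e : TangentSpace 𝓘(ℝ, E) x →L[ℝ] E :=
    mfderiv 𝓘(ℝ, E) 𝓘(ℝ, E) (extChartAt 𝓘(ℝ, E) x) x
  ((ContinuousLinearMap.precomp ℝ e).comp (B - B.flip)).comp e

/-- The differential of a function, as a 1-form. -/
def functionDeriv (f : M → ℝ) (x : M) : Cotangent E x := mfderiv 𝓘(ℝ, E) 𝓘(ℝ, ℝ) f x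

/-- The Lie derivative of a 1-form along a vector field, `L_X β = i_X dβ + d(β(X))`. -/
def lieDerivOneForm (X : ∀ x : M, TangentSpace 𝓘(ℝ, E) x) (β : ∀ x : M, Cotangent E x) (x : M) :
    Cotangent E x :=
  oneFormDeriv β x (X x) + functionDeriv (fun y => β y (X y)) x

/-- The Courant bracket
`⟦X + α, Y + β⟧ = [X, Y] + L_X β - L_Y α + (1/2) d(α(Y) - β(X))`. -/
def courantBracket (s t : ∀ x : M, GenTangent E x) (x : M) : GenTangent E x :=
  (VectorField.mlieBracket 𝓘(ℝ, E) (fun y => (s y).1) (fun y => (t y).1) x,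
    lieDerivOneForm (fun y => (s y).1) (fun y => (t y).2) x
    - lieDerivOneForm (fun y => (t y).1) (fun y => (s y).2) x
    + (1 / 2 : ℝ) • functionDeriv (fun y => ((s y).2 (t y).1 : ℝ) - ((t y).2 (s y).1 : ℝ)) x)

/-- The symmetric pairing `⟨X + α, Y + β⟩ = (β(X) + α(Y)) / 2` on the fibres of `𝕋 M`. -/
def symPairing {x : M} (p q : GenTangent E x) : ℝ :=
  (1 / 2 : ℝ) * ((q.2 p.1 : ℝ) + (p.2 q.1 : ℝ))

/-- A subspace of a fibre of `𝕋 M` is isotropic if the symmetric pairing vanishes on it. -/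
def IsIsotropic {x : M} (W : Submodule ℝ (GenTangent E x)) : Prop :=
  ∀ p ∈ W, ∀ q ∈ W, symPairing p q = 0

variable [IsManifold 𝓘(ℝ, E) ∞ M]

/-- The space of smooth sections of `L ⊆ 𝕋 M` is closed under the Courant bracket. -/
def CourantClosed (L : ∀ x : M, Submodule ℝ (GenTangent E x)) : Prop :=
  ∀ s t : SmoothSections E (E × (E →L[ℝ] ℝ)) L,
    ∃ u : SmoothSections E (E × (E →L[ℝ] ℝ)) L,
      ∀ x, (u.1 x : GenTangent E x) =
        courantBracket (fun y => (s.1 y : GenTangent E y)) (fun y => (t.1 y : GenTangent E y)) x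

/-- The anchor (projection to `TM`) and the bracket (the Courant bracket) induced by `𝕋 M` on a
family of subspaces whose space of smooth sections is closed under the Courant bracket. -/
def courantAlgebroid (L : ∀ x : M, Submodule ℝ (GenTangent E x)) (hL : CourantClosed L) :
    AlgebroidData E (E × (E →L[ℝ] ℝ)) L where
  anchor x := (LinearMap.fst ℝ _ _).comp (L x).subtype
  bracket s t := (hL s t).choose

variable (E M) in
/-- A Dirac structure on `M`: an integrable maximally isotropic subbundle of `𝕋 M`. -/
structure DiracStructure where
  fiber : ∀ x : M, Submodule ℝ (GenTangent E x)
  subbundle : IsSmoothSubbundle E (E × (E →L[ℝ] ℝ)) fiber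
  maximal_isotropic : ∀ x, Maximal IsIsotropic (fiber x)
  integrable : CourantClosed fiber

/-- The anchor and bracket of a Dirac structure. -/
def DiracStructure.algebroid (L : DiracStructure E M) :
    AlgebroidData E (E × (E →L[ℝ] ℝ)) L.fiber :=
  courantAlgebroid L.fiber L.integrable

variable {E' : Type*} [NormedAddCommGroup E'] [NormedSpace ℝ E']
  {N : Type*} [TopologicalSpace N] [ChartedSpace E' N]

/-- The pullback `φ^* α` of a covector `α` at `φ(x)`. -/
def pullbackCovector (φ : M → N) (x : M) (α : Cotangent E' (φ x)) : Cotangent E x :=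
  α.comp (mfderiv 𝓘(ℝ, E) 𝓘(ℝ, E') φ x)

/-- The backward image
`B_φ(K) = {X + φ^* α ∈ T_x M ⊕ T^*_x M : φ_* X + α ∈ K_{φ(x)}}`. -/
def backwardImage (φ : M → N) (K : ∀ y : N, Submodule ℝ (GenTangent E' y)) (x : M) :
    Submodule ℝ (GenTangent E x) where
  carrier := {p | ∃ α : Cotangent E' (φ x), p.2 = pullbackCovector φ x α ∧
    ((mfderiv 𝓘(ℝ, E) 𝓘(ℝ, E') φ x p.1, α) : GenTangent E' (φ x)) ∈ K (φ x)}
  add_mem' := by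
    rintro p q ⟨α, hα, h⟩ ⟨β, hβ, h'⟩
    refine ⟨α + β, ?_, ?_⟩
    · simp [hα, hβ, pullbackCovector]
    · simpa using (K (φ x)).add_mem h h'
  zero_mem' := ⟨0, by simp [pullbackCovector], by
    have h : ((mfderiv 𝓘(ℝ, E) 𝓘(ℝ, E') φ x (0 : GenTangent E x).1, 0) : GenTangent E' (φ x)) = 0 :=
      Prod.ext (map_zero _) rfl
    exact h ▸ (K (φ x)).zero_mem⟩
  smul_mem' := by
    rintro c p ⟨α, hα, h⟩
    refine ⟨c • α, ?_, ?_⟩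
    · simp [hα, pullbackCovector]
    · simpa using (K (φ x)).smul_mem c h

/-- The forward image, at `x`,
`F_φ(L) = {φ_* X + α ∈ T_{φ(x)} N ⊕ T^*_{φ(x)} N : X + φ^* α ∈ L_x}`. -/
def forwardImage (φ : M → N) (L : ∀ x : M, Submodule ℝ (GenTangent E x)) (x : M) :
    Set (GenTangent E' (φ x)) :=
  {q | ∃ X : TangentSpace 𝓘(ℝ, E) x, ∃ α : Cotangent E' (φ x),
    q = (mfderiv 𝓘(ℝ, E) 𝓘(ℝ, E') φ x X, α) ∧
      ((X, pullbackCovector φ x α) : GenTangent E x) ∈ L x}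

/-- `φ : (M, L) → (N, K)` is a backward Dirac map: `L = B_φ(K)`. -/
def IsBackwardDirac (φ : M → N) (L : ∀ x : M, Submodule ℝ (GenTangent E x))
    (K : ∀ y : N, Submodule ℝ (GenTangent E' y)) : Prop :=
  ∀ x, L x = backwardImage φ K x

/-- `φ : (M, L) → (N, K)` is a forward Dirac map: `φ^! K = F_φ(L)`. -/
def IsForwardDirac (φ : M → N) (L : ∀ x : M, Submodule ℝ (GenTangent E x))
    (K : ∀ y : N, Submodule ℝ (GenTangent E' y)) : Prop :=
  ∀ x, (K (φ x) : Set (GenTangent E' (φ x))) = forwardImage φ L x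

end Dirac

end

set_option linter.unusedSectionVars false

noncomputable section

/-! The candidate inverse of `X + φ^*β ↦ (X, φ_*X + β)` is `(X, Y + β) ↦ X + φ^*β`
(`pullbackToGen`). Since `φ_*` is onto, `φ^*` is injective on covectors, so `β` can be recovered
from `φ^*β` and the two bundles are fibrewise isomorphic. The bracket on `φ^{!!}K` is therefore
obtained by transporting the Courant bracket from `B_φ(K)`, and no separate check of the Lie
algebroid axioms on `φ^{!!}K` is needed.

Three ingredients carry this. (a) The Leibniz rule and the Jacobi identity fail for the Courant
bracket only by terms built from the pairing. On an isotropic family closed under the bracket these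
terms vanish, which gives a Lie algebroid (`isLieAlgebroid_courantAlgebroid`).

(b) If two sections of `𝕋M` are related through `φ` to `∑ f i ⊗ α i` and `∑ g j ⊗ β j`, their
Courant bracket is related to the prescribed expression in `f`, `g`, `α`, `β`
(`courantBracket_pullback`). The ingredients are `[X, Y]q = X(Yq) - Y(Xq)`, the naturality of `d`,
and a cancellation due to isotropy. This yields both the closedness of `B_φ(K)` and the bracket
formula for the transported structure.

(c) A submersion splits locally (`exists_local_splitting`), which gives smooth frames of both
bundles. A frame of `K`, cut off by bump functions, represents every section of `φ^{!!}K` near any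
point by a finite sum (`exists_local_representation`), so the formula determines the bracket.

A b-Dirac map is f-Dirac by the same two facts: vectors lift through `φ_*`, and `φ^*` is injective.
-/

variable {E : Type*} [NormedAddCommGroup E] [NormedSpace ℝ E]
  {M : Type*} [TopologicalSpace M] [ChartedSpace E M] [IsManifold 𝓘(ℝ, E) ∞ M]
  {E' : Type*} [NormedAddCommGroup E'] [NormedSpace ℝ E']
  {N : Type*} [TopologicalSpace N] [ChartedSpace E' N] [IsManifold 𝓘(ℝ, E') ∞ N]

/-! ### Smoothness of vectors and covectors along a map -/

variable (E) in
/-- Smoothness of a function at a point. -/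
abbrev SmoothFun (f : M → ℝ) (x : M) : Prop := ContMDiffAt 𝓘(ℝ, E) 𝓘(ℝ, ℝ) ∞ f x

variable (E) in
/-- Smoothness at a point of a vector field along a map `b`. -/
abbrev SmoothVec (b : M → N) (v : ∀ m, TangentSpace 𝓘(ℝ, E') (b m)) (x : M) : Prop :=
  ContMDiffAt 𝓘(ℝ, E) (𝓘(ℝ, E').prod 𝓘(ℝ, E')) ∞
    (fun m => TotalSpace.mk' E' (E := fun y : N => TangentSpace 𝓘(ℝ, E') y) (b m) (v m)) x

variable (E) in
/-- Smoothness at a point of a field of covectors along a map `b`. -/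
abbrev SmoothCov (b : M → N) (β : ∀ m, Cotangent E' (b m)) (x : M) : Prop :=
  ContMDiffAt 𝓘(ℝ, E) (𝓘(ℝ, E').prod 𝓘(ℝ, E' →L[ℝ] ℝ)) ∞
    (fun m => TotalSpace.mk' (E' →L[ℝ] ℝ) (E := fun y : N => Cotangent E' y) (b m) (β m)) x

variable (E) in
/-- Smoothness at a point of a section of the generalized tangent bundle along a map `b`. -/
abbrev SmoothGen (b : M → N) (s : ∀ m, GenTangent E' (b m)) (x : M) : Prop :=
  ContMDiffAt 𝓘(ℝ, E) (𝓘(ℝ, E').prod 𝓘(ℝ, E' × (E' →L[ℝ] ℝ))) ∞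
    (fun m => TotalSpace.mk' (E' × (E' →L[ℝ] ℝ)) (E := fun y : N => GenTangent E' y) (b m) (s m)) x

lemma SmoothVec.mfderiv {φ : M → N} {x : M} (hφ : ContMDiffAt 𝓘(ℝ, E) 𝓘(ℝ, E') ∞ φ x)
    {X : ∀ m : M, TangentSpace 𝓘(ℝ, E) m} (hX : SmoothVec E id X x) :
    SmoothVec E φ (fun m => mfderiv 𝓘(ℝ, E) 𝓘(ℝ, E') φ m (X m)) x := by
  have h := hφ.mfderiv_const (m := ∞) (by simp)
  exact ContMDiffAt.clm_apply_of_inCoordinates h hX hφ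

lemma SmoothCov.apply {b : M → N} {x : M} {β : ∀ m, Cotangent E' (b m)}
    {v : ∀ m, TangentSpace 𝓘(ℝ, E') (b m)} (hβ : SmoothCov E b β x) (hv : SmoothVec E b v x) :
    SmoothFun E (fun m => β m (v m)) x := by
  have h := ContMDiffAt.clm_bundle_apply hβ hv
  exact (contMDiffAt_totalSpace.1 h).2

lemma SmoothFun.dirDeriv {f : M → ℝ} {x : M} (hf : SmoothFun E f x)
    {X : ∀ m : M, TangentSpace 𝓘(ℝ, E) m} (hX : SmoothVec E id X x) :
    SmoothFun E (fun m => dirDeriv f m (X m)) x := by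
  have h := SmoothVec.mfderiv hf hX
  exact (contMDiff_snd_tangentBundle_modelSpace ℝ 𝓘(ℝ, ℝ)).contMDiffAt.comp x h

lemma smoothGen_iff {b : M → N} {s : ∀ m, GenTangent E' (b m)} {x : M} :
    SmoothGen E b s x ↔ SmoothVec E b (fun m => (s m).1) x ∧ SmoothCov E b (fun m => (s m).2) x := by
  simp only [SmoothGen, SmoothVec, SmoothCov, contMDiffAt_totalSpace]
  have : ∀ (f : M → E') (g : M → E' →L[ℝ] ℝ), ContMDiffAt 𝓘(ℝ, E) 𝓘(ℝ, E' × (E' →L[ℝ] ℝ)) ∞ (fun m => (f m, g m)) x ↔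
    ContMDiffAt 𝓘(ℝ, E) 𝓘(ℝ, E') ∞ f x ∧ ContMDiffAt 𝓘(ℝ, E) 𝓘(ℝ, E' →L[ℝ] ℝ) ∞ g x := by
    intro f g
    exact contMDiffAt_prod_module_iff (fun m => (f m, g m))
  refine Iff.trans (and_congr_right fun _ => this _ _) ?_
  tauto

lemma SmoothVec.extend {x : M} (v : TangentSpace 𝓘(ℝ, E) x) :
    SmoothVec E id (FiberBundle.extend E (E := (TangentSpace 𝓘(ℝ, E) : M → Type _)) v) x :=
  FiberBundle.contMDiffAt_extend 𝓘(ℝ, E) E v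

lemma clm_eq_sum_basis [FiniteDimensional ℝ E] {ι : Type*} [Fintype ι] (b : Module.Basis ι ℝ E) (A : E →L[ℝ] ℝ) :
    A = ∑ i, A (b i) • (LinearMap.toContinuousLinearMap (b.coord i)) := by
  ext v
  conv_lhs => rw [← b.sum_repr v]
  rw [map_sum]
  simp [mul_comm]

/-- The coefficients of a covector field are its values on a local frame, so testing against such
fields is enough. This lets formulas for the values of a one-form prove its smoothness. -/
lemma smoothCov_of_apply [FiniteDimensional ℝ E'] {b : M → N} {x : M} {β : ∀ m, Cotangent E' (b m)}
    (hb : ContMDiffAt 𝓘(ℝ, E) 𝓘(ℝ, E') ∞ b x)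
    (h : ∀ W : ∀ y : N, TangentSpace 𝓘(ℝ, E') y, (∀ᶠ y in 𝓝 (b x), SmoothVec E' id W y) →
      SmoothFun E (fun m => β m (W (b m))) x) : SmoothCov E b β x := by
  refine (contMDiffAt_hom_bundle _).2 ⟨hb, ?_⟩
  set e := trivializationAt E' (TangentSpace 𝓘(ℝ, E') : N → Type _) (b x) with he
  let B := Module.finBasis ℝ E'
  have hx : b x ∈ e.baseSet := mem_baseSet_trivializationAt E' _ (b x)
  have key : ∀ᶠ m in 𝓝 x, ContinuousLinearMap.inCoordinates E' (TangentSpace 𝓘(ℝ, E') : N → Type _) ℝ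
      (Trivial N ℝ) (b x) (b m) (b x) (b m) (β m) =
      ∑ i, (β m (e.localFrame B i (b m)) : ℝ) • LinearMap.toContinuousLinearMap (B.coord i) := by
    filter_upwards [hb.continuousAt.preimage_mem_nhds (e.open_baseSet.mem_nhds hx)] with m hm
    rw [clm_eq_sum_basis B (ContinuousLinearMap.inCoordinates _ _ _ _ _ _ _ _ _)]
    congr 1
    ext1 i
    congr 1
    have hm' : b m ∈ e.baseSet := hm
    rw [ContinuousLinearMap.inCoordinates_eq hm (by simp)]
    simp [e.localFrame_apply_of_mem_baseSet B hm', Bundle.Trivialization.basisAt]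
    rfl
  refine ContMDiffAt.congr_of_eventuallyEq ?_ key
  refine ContMDiffAt.sum fun i _ => ?_
  have h2 : ContMDiffAt 𝓘(ℝ, E) 𝓘(ℝ, E' →L[ℝ] ℝ) ∞
      (fun _ : M => LinearMap.toContinuousLinearMap (B.coord i)) x := contMDiffAt_const
  have h1 : ContMDiffAt 𝓘(ℝ, E) 𝓘(ℝ, ℝ) ∞ (fun m => (β m (e.localFrame B i (b m)) : ℝ)) x :=
    h _ ((e.open_baseSet.eventually_mem hx).mono fun y hy => contMDiffAt_localFrame_of_mem ∞ e B i hy)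
  exact ContMDiffAt.smul h1 h2

/-! ### Lie brackets of vector fields and derivatives of functions -/

lemma SmoothVec.mlieBracket {X Y : ∀ m : M, TangentSpace 𝓘(ℝ, E) m} {x : M} [CompleteSpace E]
    (hX : SmoothVec E id X x) (hY : SmoothVec E id Y x) :
    SmoothVec E id (VectorField.mlieBracket 𝓘(ℝ, E) X Y) x := by
  have : IsManifold 𝓘(ℝ, E) (minSmoothness ℝ 2) M :=
    .of_le (n := ∞) (by simpa using ENat.LEInfty.out)
  have : IsManifold 𝓘(ℝ, E) ((⊤ : ℕ∞) + 1) M := .of_le (n := ∞) (by simp)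
  exact ContMDiffAt.mlieBracket_vectorField (m := ⊤) (n := ⊤) hX hY (by simp)

lemma SmoothVec.mdifferentiableAt {X : ∀ m : M, TangentSpace 𝓘(ℝ, E) m} {x : M}
    (hX : SmoothVec E id X x) : MDifferentiableAt 𝓘(ℝ, E) (𝓘(ℝ, E).prod 𝓘(ℝ, E))
      (fun m => TotalSpace.mk' E (E := fun y : M => TangentSpace 𝓘(ℝ, E) y) m (X m)) x :=
  ContMDiffAt.mdifferentiableAt hX (by simp)

lemma mlieBracket_smul_right' [CompleteSpace E] {X Y : ∀ m : M, TangentSpace 𝓘(ℝ, E) m} {x : M}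
    {f : M → ℝ} (hf : MDifferentiableAt 𝓘(ℝ, E) 𝓘(ℝ, ℝ) f x)
    (hY : MDifferentiableAt 𝓘(ℝ, E) (𝓘(ℝ, E).prod 𝓘(ℝ, E))
      (fun m => TotalSpace.mk' E (E := fun y : M => TangentSpace 𝓘(ℝ, E) y) m (Y m)) x) :
    VectorField.mlieBracket 𝓘(ℝ, E) X (fun y => f y • Y y) x =
      dirDeriv f x (X x) • Y x + f x • VectorField.mlieBracket 𝓘(ℝ, E) X Y x :=
  have : IsManifold 𝓘(ℝ, E) 2 M := .of_le (n := ∞) ENat.LEInfty.out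
  VectorField.mlieBracket_smul_right hf hY

lemma SmoothFun.mdiff {f : M → ℝ} {x : M} (hf : SmoothFun E f x) :
    MDifferentiableAt 𝓘(ℝ, E) 𝓘(ℝ, ℝ) f x := hf.mdifferentiableAt (by simp)

lemma SmoothFun.eventually_mdiff {f : M → ℝ} {x : M} (hf : SmoothFun E f x) :
    ∀ᶠ y in 𝓝 x, MDifferentiableAt 𝓘(ℝ, E) 𝓘(ℝ, ℝ) f y :=
  (contMDiffAt_iff_contMDiffAt_nhds (by simp)).1 (ContMDiffAt.of_le hf (m := 1) ENat.LEInfty.out) |>.mono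
    fun _ h => h.mdifferentiableAt (by simp)

lemma SmoothVec.eventually_mdiff {X : ∀ m : M, TangentSpace 𝓘(ℝ, E) m} {x : M}
    (hX : SmoothVec E id X x) : ∀ᶠ y in 𝓝 x, MDifferentiableAt 𝓘(ℝ, E) (𝓘(ℝ, E).prod 𝓘(ℝ, E))
      (fun m => TotalSpace.mk' E (E := fun y : M => TangentSpace 𝓘(ℝ, E) y) m (X m)) y :=
  (contMDiffAt_iff_contMDiffAt_nhds (by simp)).1 (ContMDiffAt.of_le hX (m := 1) ENat.LEInfty.out) |>.mono
    fun _ h => h.mdifferentiableAt (by simp)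

lemma mlieBracket_add_right' [CompleteSpace E] {X Y Z : ∀ m : M, TangentSpace 𝓘(ℝ, E) m} {x : M}
    (hY : SmoothVec E id Y x) (hZ : SmoothVec E id Z x) :
    VectorField.mlieBracket 𝓘(ℝ, E) X (fun y => Y y + Z y) x =
      VectorField.mlieBracket 𝓘(ℝ, E) X Y x + VectorField.mlieBracket 𝓘(ℝ, E) X Z x :=
  have : IsManifold 𝓘(ℝ, E) 2 M := .of_le (n := ∞) ENat.LEInfty.out
  VectorField.mlieBracket_add_right hY.mdifferentiableAt hZ.mdifferentiableAt

lemma mlieBracket_jacobi [CompleteSpace E] {X Y Z : ∀ m : M, TangentSpace 𝓘(ℝ, E) m} {x : M}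
    (hX : SmoothVec E id X x) (hY : SmoothVec E id Y x) (hZ : SmoothVec E id Z x) :
    VectorField.mlieBracket 𝓘(ℝ, E) X (VectorField.mlieBracket 𝓘(ℝ, E) Y Z) x =
      VectorField.mlieBracket 𝓘(ℝ, E) (VectorField.mlieBracket 𝓘(ℝ, E) X Y) Z x +
        VectorField.mlieBracket 𝓘(ℝ, E) Y (VectorField.mlieBracket 𝓘(ℝ, E) X Z) x :=
  have h2 : minSmoothness ℝ 2 ≤ ∞ := by simpa using ENat.LEInfty.out
  have : IsManifold 𝓘(ℝ, E) (minSmoothness ℝ 3) M :=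
    .of_le (n := ∞) (by simpa using ENat.LEInfty.out)
  VectorField.leibniz_identity_mlieBracket_apply (hX.of_le h2) (hY.of_le h2) (hZ.of_le h2)

lemma SmoothVec.smul {v : ∀ m : M, TangentSpace 𝓘(ℝ, E) m} {x : M} {f : M → ℝ}
    (hf : SmoothFun E f x) (hv : SmoothVec E id v x) : SmoothVec E id (fun m => f m • v m) x :=
  ContMDiffAt.smul_section hf hv

lemma dirDeriv_mul {f g : M → ℝ} {x : M} (hf : SmoothFun E f x) (hg : SmoothFun E g x)
    (v : TangentSpace 𝓘(ℝ, E) x) :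
    dirDeriv (fun y => f y * g y) x v = f x * dirDeriv g x v + g x * dirDeriv f x v := by
  have := (hf.mdifferentiableAt (by simp)).hasMFDerivAt.mul (hg.mdifferentiableAt (by simp)).hasMFDerivAt
  have h2 := this.mfderiv
  unfold dirDeriv
  erw [h2]
  rfl

lemma dirDeriv_add {f g : M → ℝ} {x : M} (hf : SmoothFun E f x) (hg : SmoothFun E g x)
    (v : TangentSpace 𝓘(ℝ, E) x) :
    dirDeriv (fun y => f y + g y) x v = dirDeriv f x v + dirDeriv g x v := by
  have := (hf.mdifferentiableAt (by simp)).hasMFDerivAt.add (hg.mdifferentiableAt (by simp)).hasMFDerivAt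
  have h2 := this.mfderiv
  unfold dirDeriv
  erw [h2]
  rfl

lemma dirDeriv_congr {f g : M → ℝ} {x : M} (h : f =ᶠ[𝓝 x] g) (v : TangentSpace 𝓘(ℝ, E) x) :
    dirDeriv f x v = dirDeriv g x v := by
  unfold dirDeriv
  rw [h.mfderiv_eq]
  rfl

lemma dirDeriv_const (c : ℝ) (x : M) (v : TangentSpace 𝓘(ℝ, E) x) :
    dirDeriv (fun _ => c) x v = 0 := by
  unfold dirDeriv
  rw [mfderiv_const]
  rfl

lemma dirDeriv_sum {ι : Type*} (s : Finset ι) {f : ι → M → ℝ} {x : M} (hf : ∀ i ∈ s, SmoothFun E (f i) x)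
    (v : TangentSpace 𝓘(ℝ, E) x) :
    dirDeriv (fun y => ∑ i ∈ s, f i y) x v = ∑ i ∈ s, dirDeriv (f i) x v := by
  classical
  induction s using Finset.induction_on with
  | empty => simp [dirDeriv_const]
  | insert a s ha ih =>
    simp only [Finset.sum_insert ha]
    rw [dirDeriv_add (hf a (by simp)) (ContMDiffAt.sum fun i hi => hf i (by simp [hi])),
      ih fun i hi => hf i (by simp [hi])]

lemma dirDeriv_comp {φ : M → N} {x : M} (hφ : ContMDiffAt 𝓘(ℝ, E) 𝓘(ℝ, E') ∞ φ x) {q : N → ℝ}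
    (hq : SmoothFun E' q (φ x)) (v : TangentSpace 𝓘(ℝ, E) x) :
    dirDeriv (fun y => q (φ y)) x v = dirDeriv q (φ x) (mfderiv 𝓘(ℝ, E) 𝓘(ℝ, E') φ x v) := by
  have := mfderiv_comp x (hq.mdifferentiableAt (by simp)) (hφ.mdifferentiableAt (by simp))
  unfold dirDeriv
  erw [this]
  rfl

@[simp] lemma dirDeriv_vec_zero (f : M → ℝ) (x : M) :
    dirDeriv f x (0 : TangentSpace 𝓘(ℝ, E) x) = 0 := map_zero _

@[simp] lemma dirDeriv_vec_add (f : M → ℝ) (x : M) (v w : TangentSpace 𝓘(ℝ, E) x) :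
    dirDeriv f x (v + w) = dirDeriv f x v + dirDeriv f x w := map_add _ _ _

@[simp] lemma dirDeriv_vec_sub (f : M → ℝ) (x : M) (v w : TangentSpace 𝓘(ℝ, E) x) :
    dirDeriv f x (v - w) = dirDeriv f x v - dirDeriv f x w := map_sub _ _ _

@[simp] lemma dirDeriv_vec_smul (f : M → ℝ) (x : M) (c : ℝ) (v : TangentSpace 𝓘(ℝ, E) x) :
    dirDeriv f x (c • v) = c * dirDeriv f x v := map_smul (mfderiv 𝓘(ℝ, E) 𝓘(ℝ, ℝ) f x) _ _

@[simp] lemma dirDeriv_vec_sum {ι : Type*} (s : Finset ι) (f : M → ℝ) (x : M) (v : ι → TangentSpace 𝓘(ℝ, E) x) :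
    dirDeriv f x (∑ i ∈ s, v i) = ∑ i ∈ s, dirDeriv f x (v i) := map_sum _ _ _

/-- The action of `[X, Y]` on functions is extracted from the Leibniz rule and the Jacobi identity
for vector fields: apply Jacobi to `X`, `Y` and `f W` with `W x ≠ 0`, and compare the coefficients
of `W x`. -/
lemma dirDeriv_mlieBracket [CompleteSpace E] {f : M → ℝ} {X Y : ∀ m : M, TangentSpace 𝓘(ℝ, E) m} {x : M}
    (hf : SmoothFun E f x) (hX : SmoothVec E id X x) (hY : SmoothVec E id Y x) :
    dirDeriv f x (VectorField.mlieBracket 𝓘(ℝ, E) X Y x) =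
      dirDeriv (fun y => dirDeriv f y (Y y)) x (X x) -
      dirDeriv (fun y => dirDeriv f y (X y)) x (Y x) := by
  -- If the tangent space is zero no such `W` exists, but then every term vanishes.
  by_cases h0 : ∀ v : TangentSpace 𝓘(ℝ, E) x, v = 0
  · simp only [h0 (VectorField.mlieBracket 𝓘(ℝ, E) X Y x), h0 (X x), h0 (Y x)]
    simp
  push Not at h0
  obtain ⟨w, hw⟩ := h0
  let W := FiberBundle.extend E (E := (TangentSpace 𝓘(ℝ, E) : M → Type _)) w
  have hW : SmoothVec E id W x := SmoothVec.extend w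
  have hWx : W x = w := by simp [W]
  have main : ∀ {X Y : ∀ m : M, TangentSpace 𝓘(ℝ, E) m}, SmoothVec E id X x → SmoothVec E id Y x →
    VectorField.mlieBracket 𝓘(ℝ, E) X (VectorField.mlieBracket 𝓘(ℝ, E) Y (fun y => f y • W y)) x =
     dirDeriv (fun y => dirDeriv f y (Y y)) x (X x) • W x +
     dirDeriv f x (Y x) • VectorField.mlieBracket 𝓘(ℝ, E) X W x +
     (dirDeriv f x (X x) • VectorField.mlieBracket 𝓘(ℝ, E) Y W x +
     f x • VectorField.mlieBracket 𝓘(ℝ, E) X (VectorField.mlieBracket 𝓘(ℝ, E) Y W) x) := by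
    intro X Y hX hY
    have h : VectorField.mlieBracket 𝓘(ℝ, E) Y (fun y => f y • W y) =ᶠ[𝓝 x] fun y =>
        dirDeriv f y (Y y) • W y + f y • VectorField.mlieBracket 𝓘(ℝ, E) Y W y := by
      filter_upwards [hf.eventually_mdiff, hW.eventually_mdiff] with y h1 h2
      exact mlieBracket_smul_right' h1 h2
    rw [EventuallyEq.mlieBracket_vectorField_eq (EventuallyEq.refl _ X) h,
      mlieBracket_add_right' (hW.smul (hf.dirDeriv hY)) ((hY.mlieBracket hW).smul hf),
      mlieBracket_smul_right' (hf.dirDeriv hY).mdiff hW.mdifferentiableAt,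
      mlieBracket_smul_right' hf.mdiff (hY.mlieBracket hW).mdifferentiableAt]
  have j := mlieBracket_jacobi hX hY (hW.smul hf)
  rw [main hX hY, main hY hX, mlieBracket_smul_right' hf.mdiff hW.mdifferentiableAt,
    mlieBracket_jacobi hX hY hW, hWx] at j
  have j2 : (dirDeriv f x (VectorField.mlieBracket 𝓘(ℝ, E) X Y x) -
      (dirDeriv (fun y => dirDeriv f y (Y y)) x (X x) -
      dirDeriv (fun y => dirDeriv f y (X y)) x (Y x))) • w = 0 := by
    rw [← sub_eq_zero] at j
    rw [← neg_zero, ← j]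
    module
  exact sub_eq_zero.1 ((smul_eq_zero.1 j2).resolve_right hw)

lemma SmoothFun.mul {f g : M → ℝ} {x : M} (hf : SmoothFun E f x) (hg : SmoothFun E g x) :
    SmoothFun E (fun y => f y * g y) x := ContMDiffAt.mul hf hg

lemma SmoothFun.add {f g : M → ℝ} {x : M} (hf : SmoothFun E f x) (hg : SmoothFun E g x) :
    SmoothFun E (fun y => f y + g y) x := ContMDiffAt.add hf hg

lemma SmoothFun.sub {f g : M → ℝ} {x : M} (hf : SmoothFun E f x) (hg : SmoothFun E g x) :
    SmoothFun E (fun y => f y - g y) x := ContMDiffAt.sub hf hg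

lemma SmoothFun.sum {ι : Type*} {s : Finset ι} {f : ι → M → ℝ} {x : M}
    (hf : ∀ i ∈ s, SmoothFun E (f i) x) : SmoothFun E (fun y => ∑ i ∈ s, f i y) x :=
  ContMDiffAt.sum hf

/-! ### The exterior derivative of one-forms -/

lemma tendsto_extChartAt_symm (x : M) :
    Tendsto (extChartAt 𝓘(ℝ, E) x).symm (𝓝 (extChartAt 𝓘(ℝ, E) x x)) (𝓝 x) := by
  have := (continuousAt_extChartAt_symm (I := 𝓘(ℝ, E)) x).tendsto
  rwa [extChartAt_to_inv] at this

lemma contMDiffAt_extChartAt_symm_center (x : M) :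
    ContMDiffAt 𝓘(ℝ, E) 𝓘(ℝ, E) ∞ (extChartAt 𝓘(ℝ, E) x).symm (extChartAt 𝓘(ℝ, E) x x) := by
  exact (contMDiffOn_extChartAt_symm x).contMDiffAt (extChartAt_target_mem_nhds x)

lemma SmoothFun.contDiffAt_comp_extChartAt_symm {q : M → ℝ} {x : M} (hq : SmoothFun E q x) :
    ContDiffAt ℝ ∞ (fun z => q ((extChartAt 𝓘(ℝ, E) x).symm z)) (extChartAt 𝓘(ℝ, E) x x) := by
  refine ContMDiffAt.contDiffAt ?_
  refine ContMDiffAt.comp (g := q) (extChartAt 𝓘(ℝ, E) x x) ?_ (contMDiffAt_extChartAt_symm_center x)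
  rwa [extChartAt_to_inv]

/-- The coordinate expression, in the preferred chart at `x`, of a tangent vector at `x`. -/
def chartVec (x : M) (v : TangentSpace 𝓘(ℝ, E) x) : E :=
  mfderiv 𝓘(ℝ, E) 𝓘(ℝ, E) (extChartAt 𝓘(ℝ, E) x) x v

lemma oneFormDeriv_apply (β : ∀ x : M, Cotangent E x) (x : M) (u v : TangentSpace 𝓘(ℝ, E) x) :
    oneFormDeriv β x u v =
      fderiv ℝ (oneFormInChart β x) (extChartAt 𝓘(ℝ, E) x x) (chartVec x u) (chartVec x v) -
      fderiv ℝ (oneFormInChart β x) (extChartAt 𝓘(ℝ, E) x x) (chartVec x v) (chartVec x u) :=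
  rfl

lemma dirDeriv_eq_fderiv_comp_extChartAt_symm {q : M → ℝ} {x : M} (hq : SmoothFun E q x) (v : TangentSpace 𝓘(ℝ, E) x) :
    fderiv ℝ (fun z => q ((extChartAt 𝓘(ℝ, E) x).symm z)) (extChartAt 𝓘(ℝ, E) x x)
      (chartVec x v) = dirDeriv q x v := by
  have h1 : SmoothFun E (fun z => q ((extChartAt 𝓘(ℝ, E) x).symm z)) (extChartAt 𝓘(ℝ, E) x x) :=
    hq.contDiffAt_comp_extChartAt_symm.contMDiffAt
  have h2 := dirDeriv_comp (φ := extChartAt 𝓘(ℝ, E) x) contMDiffAt_extChartAt h1 v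
  have h3 : (fun y => q ((extChartAt 𝓘(ℝ, E) x).symm (extChartAt 𝓘(ℝ, E) x y))) =ᶠ[𝓝 x] q := by
    filter_upwards [extChartAt_source_mem_nhds (I := 𝓘(ℝ, E)) x] with y hy
    rw [(extChartAt 𝓘(ℝ, E) x).left_inv hy]
  rw [dirDeriv_congr h3] at h2
  rw [h2]
  unfold dirDeriv
  rw [mfderiv_eq_fderiv]
  rfl

/-- The equality is needed near the centre of the chart and not only at it, because `oneFormDeriv`
differentiates this expression once more. -/
lemma functionDeriv_comp_mfderiv_extChartAt_symm {q : M → ℝ} {x : M} (hq : SmoothFun E q x) :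
    ∀ᶠ z in 𝓝 (extChartAt 𝓘(ℝ, E) x x), (functionDeriv (E := E) q ((extChartAt 𝓘(ℝ, E) x).symm z)).comp
    (mfderiv 𝓘(ℝ, E) 𝓘(ℝ, E) (extChartAt 𝓘(ℝ, E) x).symm z) =
      fderiv ℝ (fun z => q ((extChartAt 𝓘(ℝ, E) x).symm z)) z := by
  filter_upwards [(tendsto_extChartAt_symm x).eventually hq.eventually_mdiff,
    extChartAt_target_mem_nhds (I := 𝓘(ℝ, E)) x] with z h1 h2
  have h3 : ContMDiffAt 𝓘(ℝ, E) 𝓘(ℝ, E) ∞ (extChartAt 𝓘(ℝ, E) x).symm z :=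
    (contMDiffOn_extChartAt_symm x).contMDiffAt ((isOpen_extChartAt_target x).mem_nhds h2)
  have := mfderiv_comp z h1 (h3.mdifferentiableAt (by simp))
  rw [← mfderiv_eq_fderiv]
  exact this.symm

/-- This is `d(p dq) = dp ∧ dq`: the terms `p D²q` drop out by symmetry of second derivatives. Every
smooth one-form is such a sum near a point, so Cartan's formula and naturality reduce to this case.
-/
lemma oneFormDeriv_sum {ι : Type*} [Fintype ι] {p q : ι → M → ℝ} {x : M} {β : ∀ x : M, Cotangent E x}
    (hp : ∀ i, SmoothFun E (p i) x) (hq : ∀ i, SmoothFun E (q i) x)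
    (h : ∀ᶠ y in 𝓝 x, β y = ∑ i, p i y • functionDeriv (q i) y) (u v : TangentSpace 𝓘(ℝ, E) x) :
    oneFormDeriv β x u v = ∑ i, (dirDeriv (p i) x u * dirDeriv (q i) x v -
      dirDeriv (p i) x v * dirDeriv (q i) x u) := by
  set c := extChartAt 𝓘(ℝ, E) x x with hc
  set ψ := (extChartAt 𝓘(ℝ, E) x).symm with hψ
  have h1 : oneFormInChart β x =ᶠ[𝓝 c] fun z => ∑ i, p i (ψ z) • fderiv ℝ (fun z => q i (ψ z)) z := by
    filter_upwards [(tendsto_extChartAt_symm x).eventually h,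
      eventually_all.2 fun i => functionDeriv_comp_mfderiv_extChartAt_symm (hq i)] with z hz hz2
    simp only [oneFormInChart, hz]
    refine (ContinuousLinearMap.finsetSum_comp (f := mfderiv 𝓘(ℝ, E) 𝓘(ℝ, E) ψ z) (s := Finset.univ)
      (g := fun i => p i (ψ z) • functionDeriv (E := E) (q i) (ψ z))).trans ?_
    refine Finset.sum_congr rfl fun i _ => ?_
    rw [← hz2 i]
    rfl
  have hp' := fun i => (hp i).contDiffAt_comp_extChartAt_symm
  have hq' := fun i => (hq i).contDiffAt_comp_extChartAt_symm
  have hq2 : ∀ i, DifferentiableAt ℝ (fderiv ℝ (fun z => q i (ψ z))) c := fun i =>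
    ((hq' i).fderiv_right (m := 1) (by rw [one_add_one_eq_two]; exact ENat.LEInfty.out)).differentiableAt (by simp)
  have hp2 : ∀ i, DifferentiableAt ℝ (fun z => p i (ψ z)) c := fun i => (hp' i).differentiableAt (by simp)
  have hsymm : ∀ i, IsSymmSndFDerivAt ℝ (fun z => q i (ψ z)) c := fun i =>
    (hq' i).isSymmSndFDerivAt (by simpa using ENat.LEInfty.out)
  have h2 : ∀ a b : E, fderiv ℝ (oneFormInChart β x) c a b =
      ∑ i, (p i x * fderiv ℝ (fderiv ℝ (fun z => q i (ψ z))) c a b +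
       fderiv ℝ (fun z => p i (ψ z)) c a * fderiv ℝ (fun z => q i (ψ z)) c b) := by
    intro a b
    have h4 := fderiv_fun_sum (u := Finset.univ) fun i _ => (hp2 i).fun_smul (hq2 i)
    rw [h1.fderiv_eq, h4]
    simp only [sum_apply]
    refine Finset.sum_congr rfl fun i _ => ?_
    rw [fderiv_fun_smul (hp2 i) (hq2 i)]
    simp [hψ, hc]
  rw [oneFormDeriv_apply, h2, h2, ← Finset.sum_sub_distrib]
  refine Finset.sum_congr rfl fun i _ => ?_
  rw [(hsymm i).eq, dirDeriv_eq_fderiv_comp_extChartAt_symm (hp i), dirDeriv_eq_fderiv_comp_extChartAt_symm (hp i),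
    dirDeriv_eq_fderiv_comp_extChartAt_symm (hq i), dirDeriv_eq_fderiv_comp_extChartAt_symm (hq i)]
  ring

/-- The functions are chart coordinates. The tangent trivialization centred at `x` is the
differential of that chart, so its local frame is dual to their differentials. -/
lemma exists_coordinate_functions [FiniteDimensional ℝ E] (x : M) :
    ∃ (n : ℕ) (q : Fin n → M → ℝ) (W : Fin n → ∀ y : M, TangentSpace 𝓘(ℝ, E) y),
      (∀ i, SmoothFun E (q i) x) ∧ (∀ i, SmoothVec E id (W i) x) ∧
      ∀ᶠ y in 𝓝 x, ∀ v : TangentSpace 𝓘(ℝ, E) y, v = ∑ i, dirDeriv (q i) y v • W i y := by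
  let B := Module.finBasis ℝ E
  set e := trivializationAt E (TangentSpace 𝓘(ℝ, E) : M → Type _) x with he
  have hx : x ∈ e.baseSet := mem_baseSet_trivializationAt E _ x
  refine ⟨_, fun i y => B.coord i (extChartAt 𝓘(ℝ, E) x y), e.localFrame B, fun i => ?_, fun i => ?_, ?_⟩
  · exact ((LinearMap.toContinuousLinearMap (B.coord i)).contMDiff.contMDiffAt).comp x contMDiffAt_extChartAt
  · exact contMDiffAt_localFrame_of_mem ∞ e B i hx
  · filter_upwards [e.open_baseSet.mem_nhds hx] with y hy v
    have hy' : y ∈ (chartAt E x).source := hy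
    have h1 := (e.basisAt B hy).sum_repr v
    conv_lhs => rw [← h1]
    refine Finset.sum_congr rfl fun i _ => ?_
    rw [e.localFrame_apply_of_mem_baseSet B hy]
    congr 1
    have h3 := mfderiv_comp y (f := extChartAt 𝓘(ℝ, E) x) (g := fun z : E => B.coord i z) (I := 𝓘(ℝ, E)) (I' := 𝓘(ℝ, E)) (I'' := 𝓘(ℝ, ℝ))
      ((LinearMap.toContinuousLinearMap (B.coord i)).mdifferentiableAt)
      (mdifferentiableAt_extChartAt hy')
    have h4 : dirDeriv (fun y => B.coord i (extChartAt 𝓘(ℝ, E) x y)) y v =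
       B.coord i (mfderiv 𝓘(ℝ, E) 𝓘(ℝ, E) (extChartAt 𝓘(ℝ, E) x) y v) := by
      unfold dirDeriv
      erw [h3]
      have h5 := (LinearMap.toContinuousLinearMap (B.coord i)).mfderiv_eq (x := extChartAt 𝓘(ℝ, E) x y)
      erw [h5]
      rfl
    have h6 : (mfderiv 𝓘(ℝ, E) 𝓘(ℝ, E) (extChartAt 𝓘(ℝ, E) x) y v : E) =
        e.continuousLinearMapAt ℝ y v :=
      congrArg (fun A : TangentSpace 𝓘(ℝ, E) y →L[ℝ] E => A v)
        (TangentBundle.continuousLinearMapAt_trivializationAt hy').symm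
    rw [Bundle.Trivialization.continuousLinearMapAt_apply,
      Bundle.Trivialization.coe_linearMapAt_of_mem _ hy] at h6
    rw [h4]
    exact congrArg (B.coord i) h6.symm

lemma exists_eq_sum_smul_functionDeriv [FiniteDimensional ℝ E] {x : M} {β : ∀ x : M, Cotangent E x}
    (hβ : SmoothCov E id β x) : ∃ (n : ℕ) (p q : Fin n → M → ℝ), (∀ i, SmoothFun E (p i) x) ∧
      (∀ i, SmoothFun E (q i) x) ∧ ∀ᶠ y in 𝓝 x, β y = ∑ i, p i y • functionDeriv (q i) y := by
  obtain ⟨n, q, W, hq, hW, h⟩ := exists_coordinate_functions (E := E) x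
  refine ⟨n, fun i y => β y (W i y), q, fun i => hβ.apply (hW i), hq, ?_⟩
  filter_upwards [h] with y hy
  ext v
  conv_lhs => rw [hy v]
  rw [map_sum, sum_apply]
  refine Finset.sum_congr rfl fun i _ => ?_
  rw [map_smul, smul_eq_mul, mul_comm]
  rfl

/-- Cartan's formula, which frees the chart-based derivative from coordinates. For `∑ p dq` it is
the product rule combined with the action of `[X, Y]` on `q`. -/
lemma oneFormDeriv_apply_vec [FiniteDimensional ℝ E] {x : M} {β : ∀ x : M, Cotangent E x}
    {X Y : ∀ m : M, TangentSpace 𝓘(ℝ, E) m} (hβ : SmoothCov E id β x) (hX : SmoothVec E id X x)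
    (hY : SmoothVec E id Y x) :
    oneFormDeriv β x (X x) (Y x) = dirDeriv (fun y => β y (Y y)) x (X x) -
      dirDeriv (fun y => β y (X y)) x (Y x) - β x (VectorField.mlieBracket 𝓘(ℝ, E) X Y x) := by
  have : CompleteSpace E := FiniteDimensional.complete ℝ E
  obtain ⟨n, p, q, hp, hq, h⟩ := exists_eq_sum_smul_functionDeriv hβ
  have key : ∀ {X : ∀ m : M, TangentSpace 𝓘(ℝ, E) m}, (fun y => (β y (X y) : ℝ)) =ᶠ[𝓝 x]
      fun y => ∑ i, p i y * dirDeriv (q i) y (X y) := by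
    intro X
    filter_upwards [h] with y hy
    rw [hy, sum_apply]
    rfl
  have key2 : ∀ {X : ∀ m : M, TangentSpace 𝓘(ℝ, E) m}, SmoothVec E id X x →
      ∀ v : TangentSpace 𝓘(ℝ, E) x, dirDeriv (fun y => (β y (X y) : ℝ)) x v = ∑ i, (p i x * dirDeriv (fun y => dirDeriv (q i) y (X y)) x v
       + dirDeriv (q i) x (X x) * dirDeriv (p i) x v) := by
    intro X hX v
    rw [dirDeriv_congr key, dirDeriv_sum _ fun i _ => (hp i).mul ((hq i).dirDeriv hX)]
    refine Finset.sum_congr rfl fun i _ => ?_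
    rw [dirDeriv_mul (hp i) ((hq i).dirDeriv hX)]
  have key3 : (β x (VectorField.mlieBracket 𝓘(ℝ, E) X Y x) : ℝ) = _ :=
    (key (X := VectorField.mlieBracket 𝓘(ℝ, E) X Y)).eq_of_nhds
  rw [oneFormDeriv_sum hp hq h, key2 hX, key2 hY, key3, ← Finset.sum_sub_distrib, ← Finset.sum_sub_distrib]
  refine Finset.sum_congr rfl fun i _ => ?_
  rw [dirDeriv_mlieBracket (hq i) hX hY]
  ring

/-- The extension is smooth in a whole neighbourhood, as required by formulas that are
differentiated again. -/
lemma exists_smoothVec_eq {x : M} (v : TangentSpace 𝓘(ℝ, E) x) :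
    ∃ V : ∀ m : M, TangentSpace 𝓘(ℝ, E) m, (∀ᶠ y in 𝓝 x, SmoothVec E id V y) ∧ V x = v := by
  obtain ⟨s, hs, h⟩ := FiberBundle.exists_contMDiffOn_extend 𝓘(ℝ, E) E (k := ∞)
    (V := (TangentSpace 𝓘(ℝ, E) : M → Type _)) v
  obtain ⟨t, hts, ht, hxt⟩ := mem_nhds_iff.1 hs
  exact ⟨_, (ht.eventually_mem hxt).mono fun y hy => (h.mono hts).contMDiffAt (ht.mem_nhds hy),
    by simp⟩

/-- The rule `d(f γ) = df ∧ γ + f dγ`, by Cartan's formula on vector fields extending `u` and `v`: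
the bracket terms on the two sides agree. -/
lemma oneFormDeriv_sum_smul [FiniteDimensional ℝ E] {ι : Type*} [Fintype ι] {x : M} {β : ∀ x : M, Cotangent E x}
    {f : ι → M → ℝ} {γ : ι → ∀ x : M, Cotangent E x} (hf : ∀ i, SmoothFun E (f i) x)
    (hγ : ∀ i, SmoothCov E id (γ i) x) (hβ : SmoothCov E id β x)
    (h : ∀ᶠ y in 𝓝 x, β y = ∑ i, f i y • γ i y) (u v : TangentSpace 𝓘(ℝ, E) x) :
    oneFormDeriv β x u v = ∑ i, (dirDeriv (f i) x u * γ i x v - dirDeriv (f i) x v * γ i x u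
      + f i x * oneFormDeriv (γ i) x u v) := by
  obtain ⟨U, hU, rfl⟩ := exists_smoothVec_eq u
  obtain ⟨V, hV, rfl⟩ := exists_smoothVec_eq v
  replace hU := hU.self_of_nhds
  replace hV := hV.self_of_nhds
  have key : ∀ {X : ∀ m : M, TangentSpace 𝓘(ℝ, E) m}, (fun y => (β y (X y) : ℝ)) =ᶠ[𝓝 x]
      fun y => ∑ i, f i y * γ i y (X y) := by
    intro X
    filter_upwards [h] with y hy
    rw [hy, sum_apply]
    rfl
  have key2 : ∀ {X : ∀ m : M, TangentSpace 𝓘(ℝ, E) m}, SmoothVec E id X x →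
      ∀ v : TangentSpace 𝓘(ℝ, E) x, dirDeriv (fun y => (β y (X y) : ℝ)) x v = ∑ i, (f i x * dirDeriv (fun y => (γ i y (X y) : ℝ)) x v
       + γ i x (X x) * dirDeriv (f i) x v) := by
    intro X hX v
    rw [dirDeriv_congr key, dirDeriv_sum _ fun i _ => SmoothFun.mul (hf i) ((hγ i).apply hX)]
    refine Finset.sum_congr rfl fun i _ => ?_
    rw [dirDeriv_mul (hf i) ((hγ i).apply hX)]
  have key3 : (β x (VectorField.mlieBracket 𝓘(ℝ, E) U V x) : ℝ) = _ :=
    (key (X := VectorField.mlieBracket 𝓘(ℝ, E) U V)).eq_of_nhds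
  rw [oneFormDeriv_apply_vec hβ hU hV, key2 hU, key2 hV, key3, ← Finset.sum_sub_distrib, ← Finset.sum_sub_distrib]
  refine Finset.sum_congr rfl fun i _ => ?_
  rw [oneFormDeriv_apply_vec (hγ i) hU hV]
  ring

/-- Pullback sends `∑ p dq` to `∑ (p ∘ φ) d(q ∘ φ)`, so naturality of `d` becomes the chain rule. -/
lemma oneFormDeriv_pullback [FiniteDimensional ℝ E'] {φ : M → N} {x : M}
    (hφ : ContMDiffAt 𝓘(ℝ, E) 𝓘(ℝ, E') ∞ φ x) {β : ∀ y : N, Cotangent E' y}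
    (hβ : SmoothCov E' id β (φ x)) (u v : TangentSpace 𝓘(ℝ, E) x) :
    oneFormDeriv (fun y => pullbackCovector (E := E) φ y (β (φ y))) x u v =
      oneFormDeriv β (φ x) (mfderiv 𝓘(ℝ, E) 𝓘(ℝ, E') φ x u) (mfderiv 𝓘(ℝ, E) 𝓘(ℝ, E') φ x v) := by
  obtain ⟨n, p, q, hp, hq, h⟩ := exists_eq_sum_smul_functionDeriv hβ
  have h' : ∀ᶠ y in 𝓝 x, pullbackCovector (E := E) φ y (β (φ y)) =
      ∑ i, p i (φ y) • functionDeriv (E := E) (fun y => q i (φ y)) y := by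
    filter_upwards [hφ.continuousAt.eventually h, hφ.continuousAt.eventually
      (eventually_all.2 fun i => (hq i).eventually_mdiff),
      (contMDiffAt_iff_contMDiffAt_nhds (by simp)).1 (hφ.of_le (m := 1) ENat.LEInfty.out)] with y hy h2 h3
    rw [hy]
    ext w
    rw [sum_apply]
    simp only [pullbackCovector]
    erw [ContinuousLinearMap.comp_apply]
    rw [sum_apply]
    refine Finset.sum_congr rfl fun i _ => ?_
    have := mfderiv_comp y (h2 i) (h3.mdifferentiableAt (by simp))
    unfold functionDeriv
    erw [this]
    rfl
  rw [oneFormDeriv_sum (fun i => (hp i).comp x hφ) (fun i => (hq i).comp x hφ) h',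
    oneFormDeriv_sum hp hq h]
  refine Finset.sum_congr rfl fun i _ => ?_
  rw [← dirDeriv_comp hφ (hp i), ← dirDeriv_comp hφ (hp i), ← dirDeriv_comp hφ (hq i), ← dirDeriv_comp hφ (hq i)]
  rfl

lemma tangent_eq_of_dirDeriv_eq [FiniteDimensional ℝ E] {x : M} {u v : TangentSpace 𝓘(ℝ, E) x}
    (h : ∀ q : M → ℝ, SmoothFun E q x → dirDeriv q x u = dirDeriv q x v) : u = v := by
  obtain ⟨n, q, W, hq, hW, hs⟩ := exists_coordinate_functions (E := E) x
  rw [hs.self_of_nhds u, hs.self_of_nhds v]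
  exact Finset.sum_congr rfl fun i _ => by rw [h _ (hq i)]

/-! ### The Courant bracket on mutually orthogonal sections -/

section Courant

variable [FiniteDimensional ℝ E]

lemma dirDeriv_neg {f : M → ℝ} {x : M} (hf : SmoothFun E f x) (v : TangentSpace 𝓘(ℝ, E) x) :
    dirDeriv (fun y => - f y) x v = - dirDeriv f x v := by
  have h : (fun y => - f y) = fun y => (fun _ => (-1 : ℝ)) y * f y := by ext; simp
  rw [h, dirDeriv_mul contMDiffAt_const hf, dirDeriv_const]
  simp

lemma dirDeriv_sub {f g : M → ℝ} {x : M} (hf : SmoothFun E f x) (hg : SmoothFun E g x)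
    (v : TangentSpace 𝓘(ℝ, E) x) :
    dirDeriv (fun y => f y - g y) x v = dirDeriv f x v - dirDeriv g x v := by
  have h : (fun y => f y - g y) = fun y => f y + (fun y => - g y) y := by ext; simp [sub_eq_add_neg]
  rw [h, dirDeriv_add hf (ContMDiffAt.neg hg), dirDeriv_neg hg, sub_eq_add_neg]

/-- Write `σ = X + α`, `τ = Y + β`. Orthogonality gives `β(X) = -α(Y)` near the point, so the three
exact terms of the bracket collapse to `-d(α(Y))`. -/
lemma courantBracket_snd_apply {σ τ : ∀ x : M, GenTangent E x} {x : M} (hσ : SmoothGen E id σ x)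
    (hτ : SmoothGen E id τ x) (hiso : ∀ᶠ y in 𝓝 x, symPairing (σ y) (τ y) = 0)
    (u : TangentSpace 𝓘(ℝ, E) x) :
    ((courantBracket σ τ x).2 u : ℝ) = oneFormDeriv (fun y => (τ y).2) x (σ x).1 u -
      oneFormDeriv (fun y => (σ y).2) x (τ x).1 u +
      dirDeriv (fun y => ((σ y).2 (τ y).1 : ℝ)) x u * (-1) := by
  have h1 := smoothGen_iff.1 hσ
  have h2 := smoothGen_iff.1 hτ
  have h3 : SmoothFun E (fun y => ((σ y).2 (τ y).1 : ℝ)) x := h1.2.apply h2.1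
  have h4 : (fun y => ((τ y).2 (σ y).1 : ℝ)) =ᶠ[𝓝 x] fun y => - ((σ y).2 (τ y).1 : ℝ) := by
    filter_upwards [hiso] with y hy
    unfold symPairing at hy
    linarith
  have h5 : (fun y => ((σ y).2 (τ y).1 : ℝ) - ((τ y).2 (σ y).1 : ℝ)) =ᶠ[𝓝 x]
      fun y => ((σ y).2 (τ y).1 : ℝ) + ((σ y).2 (τ y).1 : ℝ) := by
    filter_upwards [h4] with y hy
    rw [hy]
    ring
  have e1 : ((courantBracket σ τ x).2 u : ℝ) =
      (oneFormDeriv (fun y => (τ y).2) x (σ x).1 u + dirDeriv (fun y => ((τ y).2 (σ y).1 : ℝ)) x u) -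
      (oneFormDeriv (fun y => (σ y).2) x (τ x).1 u + dirDeriv (fun y => ((σ y).2 (τ y).1 : ℝ)) x u) +
      (1 / 2 : ℝ) * dirDeriv (fun y => ((σ y).2 (τ y).1 : ℝ) - ((τ y).2 (σ y).1 : ℝ)) x u := rfl
  rw [e1, dirDeriv_congr h4, dirDeriv_congr h5, dirDeriv_neg h3, dirDeriv_add h3 h3]
  ring

/-- Evaluation on a test field `Z` by Cartan's formula. In this form skewness, Leibniz and Jacobi
become identities between derivatives of functions and Lie brackets of vector fields. -/
lemma courantBracket_snd_apply_vec {σ τ : ∀ x : M, GenTangent E x} {x : M} (hσ : SmoothGen E id σ x)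
    (hτ : SmoothGen E id τ x) (hiso : ∀ᶠ y in 𝓝 x, symPairing (σ y) (τ y) = 0)
    {Z : ∀ y : M, TangentSpace 𝓘(ℝ, E) y} (hZ : SmoothVec E id Z x) :
    ((courantBracket σ τ x).2 (Z x) : ℝ) =
      dirDeriv (fun y => ((τ y).2 (Z y) : ℝ)) x (σ x).1
      - (τ x).2 (VectorField.mlieBracket 𝓘(ℝ, E) (fun y => (σ y).1) Z x)
      - dirDeriv (fun y => ((σ y).2 (Z y) : ℝ)) x (τ x).1
      + (σ x).2 (VectorField.mlieBracket 𝓘(ℝ, E) (fun y => (τ y).1) Z x)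
      + dirDeriv (fun y => ((σ y).2 (τ y).1 : ℝ)) x (Z x) := by
  have h1 := smoothGen_iff.1 hσ
  have h2 := smoothGen_iff.1 hτ
  have h3 : SmoothFun E (fun y => ((σ y).2 (τ y).1 : ℝ)) x := h1.2.apply h2.1
  have h4 : (fun y => ((τ y).2 (σ y).1 : ℝ)) =ᶠ[𝓝 x] fun y => - ((σ y).2 (τ y).1 : ℝ) := by
    filter_upwards [hiso] with y hy
    unfold symPairing at hy
    linarith
  rw [courantBracket_snd_apply hσ hτ hiso, oneFormDeriv_apply_vec h2.2 h1.1 hZ,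
    oneFormDeriv_apply_vec h1.2 h2.1 hZ, dirDeriv_congr h4, dirDeriv_neg h3]
  ring

lemma smoothGen_courantBracket {σ τ : ∀ x : M, GenTangent E x} (hσ : ∀ x, SmoothGen E id σ x)
    (hτ : ∀ x, SmoothGen E id τ x) (hiso : ∀ y, symPairing (σ y) (τ y) = 0) (x : M) :
    SmoothGen E id (courantBracket σ τ) x := by
  have : CompleteSpace E := FiniteDimensional.complete ℝ E
  have h1 := fun x => smoothGen_iff.1 (hσ x)
  have h2 := fun x => smoothGen_iff.1 (hτ x)
  refine smoothGen_iff.2 ⟨(h1 x).1.mlieBracket (h2 x).1, ?_⟩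
  refine smoothCov_of_apply contMDiffAt_id fun W hW => ?_
  have hWx := hW.self_of_nhds
  have key := ((((((h2 x).2.apply hWx).dirDeriv (h1 x).1).sub
    ((h2 x).2.apply ((h1 x).1.mlieBracket hWx))).sub
    (((h1 x).2.apply hWx).dirDeriv (h2 x).1)).add ((h1 x).2.apply ((h2 x).1.mlieBracket hWx))).add
    (((h1 x).2.apply (h2 x).1).dirDeriv hWx)
  refine ContMDiffAt.congr_of_eventuallyEq key ?_
  filter_upwards [hW] with y hy
  exact courantBracket_snd_apply_vec (hσ y) (hτ y) (Eventually.of_forall hiso) hy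

lemma genTangent_ext {x : M} {p q : GenTangent E x} (h1 : p.1 = q.1)
    (h2 : ∀ Z : ∀ y : M, TangentSpace 𝓘(ℝ, E) y, (∀ᶠ y in 𝓝 x, SmoothVec E id Z y) →
      (p.2 (Z x) : ℝ) = q.2 (Z x)) : p = q := by
  refine Prod.ext h1 (ContinuousLinearMap.ext fun v => ?_)
  obtain ⟨Z, hZ, rfl⟩ := exists_smoothVec_eq v
  exact h2 Z hZ

lemma symPairing_comm {x : M} (p q : GenTangent E x) : symPairing p q = symPairing q p := by
  unfold symPairing
  rw [add_comm]

lemma courantBracket_skew (σ τ : ∀ x : M, GenTangent E x) {x : M} (hσ : SmoothGen E id σ x)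
    (hτ : SmoothGen E id τ x) (hiso : ∀ᶠ y in 𝓝 x, symPairing (σ y) (τ y) = 0) :
    courantBracket σ τ x = - courantBracket τ σ x := by
  refine genTangent_ext VectorField.mlieBracket_swap_apply fun Z hZ => ?_
  have h1 := smoothGen_iff.1 hσ
  have h2 := smoothGen_iff.1 hτ
  have hiso' : ∀ᶠ y in 𝓝 x, symPairing (τ y) (σ y) = 0 := by simpa only [symPairing_comm] using hiso
  have h4 : (fun y => ((τ y).2 (σ y).1 : ℝ)) =ᶠ[𝓝 x] fun y => - ((σ y).2 (τ y).1 : ℝ) := by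
    filter_upwards [hiso] with y hy
    unfold symPairing at hy
    linarith
  have e : ((-courantBracket τ σ x).2 (Z x) : ℝ) = - ((courantBracket τ σ x).2 (Z x) : ℝ) := rfl
  rw [e, courantBracket_snd_apply_vec hσ hτ hiso hZ.self_of_nhds,
    courantBracket_snd_apply_vec hτ hσ hiso' hZ.self_of_nhds, dirDeriv_congr h4,
    dirDeriv_neg (h1.2.apply h2.1)]
  ring

lemma courantBracket_add_right {σ τ υ : ∀ x : M, GenTangent E x} {x : M} (hσ : SmoothGen E id σ x)
    (hτ : SmoothGen E id τ x) (hυ : SmoothGen E id υ x)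
    (hτυ : SmoothGen E id (fun y => τ y + υ y) x)
    (h1 : ∀ᶠ y in 𝓝 x, symPairing (σ y) (τ y) = 0) (h2 : ∀ᶠ y in 𝓝 x, symPairing (σ y) (υ y) = 0)
    (h3 : ∀ᶠ y in 𝓝 x, symPairing (σ y) (τ y + υ y) = 0) :
    courantBracket σ (fun y => τ y + υ y) x = courantBracket σ τ x + courantBracket σ υ x := by
  have : CompleteSpace E := FiniteDimensional.complete ℝ E
  have hσ' := smoothGen_iff.1 hσ
  have hτ' := smoothGen_iff.1 hτ
  have hυ' := smoothGen_iff.1 hυ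
  refine genTangent_ext (mlieBracket_add_right' hτ'.1 hυ'.1) fun Z hZ => ?_
  replace hZ := hZ.self_of_nhds
  have e : ((courantBracket σ τ x + courantBracket σ υ x).2 (Z x) : ℝ) =
    (courantBracket σ τ x).2 (Z x) + (courantBracket σ υ x).2 (Z x) := rfl
  rw [e, courantBracket_snd_apply_vec hσ hτ h1 hZ, courantBracket_snd_apply_vec hσ hυ h2 hZ,
    courantBracket_snd_apply_vec hσ hτυ h3 hZ]
  have e1 := dirDeriv_add (hτ'.2.apply hZ) (hυ'.2.apply hZ) (σ x).1
  have e2 := dirDeriv_add (hσ'.2.apply hτ'.1) (hσ'.2.apply hυ'.1) (Z x)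
  have e3 : (fun y => ((τ y + υ y).2 (Z y) : ℝ)) = fun y => (τ y).2 (Z y) + (υ y).2 (Z y) := rfl
  have e4 : (fun y => ((σ y).2 (τ y + υ y).1 : ℝ)) = fun y => (σ y).2 (τ y).1 + (σ y).2 (υ y).1 := by
    ext y
    exact map_add _ _ _
  have e5 : VectorField.mlieBracket 𝓘(ℝ, E) (fun y => (τ y + υ y).1) Z x =
      VectorField.mlieBracket 𝓘(ℝ, E) (fun y => (τ y).1) Z x +
      VectorField.mlieBracket 𝓘(ℝ, E) (fun y => (υ y).1) Z x := by
    rw [VectorField.mlieBracket_swap_apply, VectorField.mlieBracket_swap_apply (V := fun y => (τ y).1),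
     VectorField.mlieBracket_swap_apply (V := fun y => (υ y).1)]
    rw [← neg_add, ← mlieBracket_add_right' hτ'.1 hυ'.1]
    rfl
  have e6 : dirDeriv (fun y => ((σ y).2 (Z y) : ℝ)) x (τ x + υ x).1 =
     dirDeriv (fun y => ((σ y).2 (Z y) : ℝ)) x (τ x).1 + dirDeriv (fun y => ((σ y).2 (Z y) : ℝ)) x (υ x).1 :=
    map_add _ _ _
  have e7 : ∀ v, ((τ x + υ x).2 v : ℝ) = (τ x).2 v + (υ x).2 v := fun v => rfl
  rw [e3, e4, e1, e2, e5, e6, e7, map_add]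
  ring

/-- For arbitrary sections there is a further term `-⟨σ, τ⟩ df`; orthogonality removes it. -/
lemma courantBracket_smul_right {σ τ : ∀ x : M, GenTangent E x} {x : M} {f : M → ℝ} (hf : SmoothFun E f x)
    (hσ : SmoothGen E id σ x) (hτ : SmoothGen E id τ x) (hfτ : SmoothGen E id (fun y => f y • τ y) x)
    (h1 : ∀ᶠ y in 𝓝 x, symPairing (σ y) (τ y) = 0)
    (h3 : ∀ᶠ y in 𝓝 x, symPairing (σ y) (f y • τ y) = 0) :
    courantBracket σ (fun y => f y • τ y) x =
      f x • courantBracket σ τ x + dirDeriv f x (σ x).1 • τ x := by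
  have : CompleteSpace E := FiniteDimensional.complete ℝ E
  have hσ' := smoothGen_iff.1 hσ
  have hτ' := smoothGen_iff.1 hτ
  refine genTangent_ext ((mlieBracket_smul_right' hf.mdiff hτ'.1.mdifferentiableAt).trans (add_comm _ _))
    fun Z hZ => ?_
  replace hZ := hZ.self_of_nhds
  have e : ((f x • courantBracket σ τ x + dirDeriv f x (σ x).1 • τ x).2 (Z x) : ℝ) =
    f x * (courantBracket σ τ x).2 (Z x) + dirDeriv f x (σ x).1 * (τ x).2 (Z x) := rfl
  rw [e, courantBracket_snd_apply_vec hσ hτ h1 hZ, courantBracket_snd_apply_vec hσ hfτ h3 hZ]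
  have e1 := dirDeriv_mul hf (hτ'.2.apply hZ) (σ x).1
  have e2 := dirDeriv_mul hf (hσ'.2.apply hτ'.1) (Z x)
  have e3 : (fun y => ((f y • τ y).2 (Z y) : ℝ)) = fun y => f y * (τ y).2 (Z y) := rfl
  have e4 : (fun y => ((σ y).2 (f y • τ y).1 : ℝ)) = fun y => f y * (σ y).2 (τ y).1 := by
    ext y
    exact map_smul _ _ _
  have e5 : VectorField.mlieBracket 𝓘(ℝ, E) (fun y => (f y • τ y).1) Z x =
      f x • VectorField.mlieBracket 𝓘(ℝ, E) (fun y => (τ y).1) Z x - dirDeriv f x (Z x) • (τ x).1 := by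
    rw [VectorField.mlieBracket_swap_apply, VectorField.mlieBracket_swap_apply (V := fun y => (τ y).1),
      show (fun y => (f y • τ y).1) = fun y => f y • (τ y).1 from rfl,
      mlieBracket_smul_right' hf.mdiff hτ'.1.mdifferentiableAt]
    module
  have e6 : dirDeriv (fun y => ((σ y).2 (Z y) : ℝ)) x (f x • τ x).1 =
     f x * dirDeriv (fun y => ((σ y).2 (Z y) : ℝ)) x (τ x).1 := dirDeriv_vec_smul _ _ _ _
  have e7 : ∀ v, ((f x • τ x).2 v : ℝ) = f x * (τ x).2 v := fun v => rfl
  rw [e3, e4, e1, e2, e5, e6, e7, map_sub, map_smul, map_smul, smul_eq_mul, smul_eq_mul]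
  ring

lemma dirDeriv_courantBracket_snd {σ τ : ∀ x : M, GenTangent E x} {x : M}
    (hσ : ∀ x, SmoothGen E id σ x) (hτ : ∀ x, SmoothGen E id τ x)
    (hiso : ∀ y, symPairing (σ y) (τ y) = 0) {Z : ∀ y : M, TangentSpace 𝓘(ℝ, E) y}
    (hZ : ∀ᶠ y in 𝓝 x, SmoothVec E id Z y) (v : TangentSpace 𝓘(ℝ, E) x) :
    dirDeriv (fun y => ((courantBracket σ τ y).2 (Z y) : ℝ)) x v =
      dirDeriv (fun y => dirDeriv (fun y => ((τ y).2 (Z y) : ℝ)) y (σ y).1) x v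
      - dirDeriv (fun y => ((τ y).2 (VectorField.mlieBracket 𝓘(ℝ, E) (fun y => (σ y).1) Z y) : ℝ)) x v
      - dirDeriv (fun y => dirDeriv (fun y => ((σ y).2 (Z y) : ℝ)) y (τ y).1) x v
      + dirDeriv (fun y => ((σ y).2 (VectorField.mlieBracket 𝓘(ℝ, E) (fun y => (τ y).1) Z y) : ℝ)) x v
      + dirDeriv (fun y => dirDeriv (fun y => ((σ y).2 (τ y).1 : ℝ)) y (Z y)) x v := by
  have : CompleteSpace E := FiniteDimensional.complete ℝ E
  have h1 := smoothGen_iff.1 (hσ x)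
  have h2 := smoothGen_iff.1 (hτ x)
  have hZx := hZ.self_of_nhds
  have s1 := (h2.2.apply hZx).dirDeriv h1.1
  have s2 := h2.2.apply (h1.1.mlieBracket hZx)
  have s3 := (h1.2.apply hZx).dirDeriv h2.1
  have s4 := h1.2.apply (h2.1.mlieBracket hZx)
  have s5 := (h1.2.apply h2.1).dirDeriv hZx
  rw [← dirDeriv_sub s1 s2, ← dirDeriv_sub (s1.sub s2) s3, ← dirDeriv_add ((s1.sub s2).sub s3) s4,
    ← dirDeriv_add (((s1.sub s2).sub s3).add s4) s5]
  refine dirDeriv_congr ?_ v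
  filter_upwards [hZ] with y hy
  exact courantBracket_snd_apply_vec (hσ y) (hτ y) (Eventually.of_forall hiso) hy

/-- In general the Jacobi identity fails by the differential of a combination of pairings of one
section with the bracket of the other two; `h1`, `h2`, `h3` make these vanish. The proof evaluates
both sides on a test field `Z` and reduces to calculus with vector fields. -/
lemma courantBracket_jacobi {σ τ υ : ∀ x : M, GenTangent E x}
    (hσ : ∀ x, SmoothGen E id σ x) (hτ : ∀ x, SmoothGen E id τ x) (hυ : ∀ x, SmoothGen E id υ x)
    (hστ : ∀ y, symPairing (σ y) (τ y) = 0) (hτυ : ∀ y, symPairing (τ y) (υ y) = 0)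
    (hσυ : ∀ y, symPairing (σ y) (υ y) = 0)
    (h1 : ∀ y, symPairing (σ y) (courantBracket τ υ y) = 0)
    (h2 : ∀ y, symPairing (courantBracket σ τ y) (υ y) = 0)
    (h3 : ∀ y, symPairing (τ y) (courantBracket σ υ y) = 0) (x : M) :
    courantBracket σ (courantBracket τ υ) x = courantBracket (courantBracket σ τ) υ x +
      courantBracket τ (courantBracket σ υ) x := by
  have : CompleteSpace E := FiniteDimensional.complete ℝ E
  have hσ' := smoothGen_iff.1 (hσ x)
  have hτ' := smoothGen_iff.1 (hτ x)
  have hυ' := smoothGen_iff.1 (hυ x)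
  refine genTangent_ext (mlieBracket_jacobi hσ'.1 hτ'.1 hυ'.1) fun Z hZ => ?_
  have hZx := hZ.self_of_nhds
  have bστ := smoothGen_courantBracket hσ hτ hστ
  have bτυ := smoothGen_courantBracket hτ hυ hτυ
  have bσυ := smoothGen_courantBracket hσ hυ hσυ
  have e : ((courantBracket (courantBracket σ τ) υ x + courantBracket τ (courantBracket σ υ) x).2 (Z x) : ℝ)
    = (courantBracket (courantBracket σ τ) υ x).2 (Z x) + (courantBracket τ (courantBracket σ υ) x).2 (Z x) := rfl
  rw [e, courantBracket_snd_apply_vec (hσ x) (bτυ x) (Eventually.of_forall h1) hZx,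
    courantBracket_snd_apply_vec (bστ x) (hυ x) (Eventually.of_forall h2) hZx,
    courantBracket_snd_apply_vec (hτ x) (bσυ x) (Eventually.of_forall h3) hZx,
    dirDeriv_courantBracket_snd hτ hυ hτυ hZ, dirDeriv_courantBracket_snd hσ hυ hσυ hZ,
    dirDeriv_courantBracket_snd hσ hτ hστ hZ,
    courantBracket_snd_apply_vec (hτ x) (hυ x) (Eventually.of_forall hτυ) (hσ'.1.mlieBracket hZx),
    courantBracket_snd_apply_vec (hσ x) (hυ x) (Eventually.of_forall hσυ) (hτ'.1.mlieBracket hZx),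
    courantBracket_snd_apply_vec (hσ x) (hτ x) (Eventually.of_forall hστ) (hυ'.1.mlieBracket hZx)]
  -- Derivatives along the vector part of a bracket become commutators of derivatives.
  have d1 : ∀ {f : M → ℝ}, SmoothFun E f x → dirDeriv f x (courantBracket τ υ x).1 = _ :=
    fun hf => dirDeriv_mlieBracket hf hτ'.1 hυ'.1
  have d2 : ∀ {f : M → ℝ}, SmoothFun E f x → dirDeriv f x (courantBracket σ τ x).1 = _ :=
    fun hf => dirDeriv_mlieBracket hf hσ'.1 hτ'.1
  have d3 : ∀ {f : M → ℝ}, SmoothFun E f x → dirDeriv f x (courantBracket σ υ x).1 = _ :=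
    fun hf => dirDeriv_mlieBracket hf hσ'.1 hυ'.1
  -- The Jacobi identity for vector fields replaces `[[X, Y], Z]` by `[X, [Y, Z]] - [Y, [X, Z]]`, so
  -- that every double bracket ends in a bracket with `Z`.
  have j1 : ((σ x).2 (VectorField.mlieBracket 𝓘(ℝ, E) (fun y => (courantBracket τ υ y).1) Z x) : ℝ) = _ :=
    congrArg (σ x).2 (eq_sub_of_add_eq (mlieBracket_jacobi hτ'.1 hυ'.1 hZx).symm)
  have j2 : ((υ x).2 (VectorField.mlieBracket 𝓘(ℝ, E) (fun y => (courantBracket σ τ y).1) Z x) : ℝ) = _ :=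
    congrArg (υ x).2 (eq_sub_of_add_eq (mlieBracket_jacobi hσ'.1 hτ'.1 hZx).symm)
  have j3 : ((τ x).2 (VectorField.mlieBracket 𝓘(ℝ, E) (fun y => (courantBracket σ υ y).1) Z x) : ℝ) = _ :=
    congrArg (τ x).2 (eq_sub_of_add_eq (mlieBracket_jacobi hσ'.1 hυ'.1 hZx).symm)
  rw [d1 (hσ'.2.apply hZx), d2 (hυ'.2.apply hZx), d3 (hτ'.2.apply hZx), j1, j2, j3,
    map_sub, map_sub, map_sub,
    dirDeriv_courantBracket_snd hσ hτ hστ (Eventually.of_forall fun y => (smoothGen_iff.1 (hυ y)).1),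
    dirDeriv_mlieBracket (hτ'.2.apply hυ'.1) hσ'.1 hZx,
    dirDeriv_mlieBracket (hσ'.2.apply hυ'.1) hτ'.1 hZx,
    dirDeriv_mlieBracket (hσ'.2.apply hτ'.1) hυ'.1 hZx]
  have e1 : (fun y => ((σ y).2 (courantBracket τ υ y).1 : ℝ)) =
    fun y => (σ y).2 (VectorField.mlieBracket 𝓘(ℝ, E) (fun y => (τ y).1) (fun y => (υ y).1) y) := rfl
  have e2 : (fun y => ((τ y).2 (courantBracket σ υ y).1 : ℝ)) =
    fun y => (τ y).2 (VectorField.mlieBracket 𝓘(ℝ, E) (fun y => (σ y).1) (fun y => (υ y).1) y) := rfl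
  rw [e1, e2]
  ring

end Courant

/-! ### The Lie algebroid of an isotropic, Courant-closed subbundle -/

section CourantAlgebroid

variable {L : ∀ x : M, Submodule ℝ (GenTangent E x)}

lemma courantAlgebroid_bracket_apply (hL : CourantClosed L)
    (s t : SmoothSections E (E × (E →L[ℝ] ℝ)) L) (x : M) :
    (((courantAlgebroid L hL).bracket s t).1 x : GenTangent E x) =
      courantBracket (fun y => (s.1 y : GenTangent E y)) (fun y => (t.1 y : GenTangent E y)) x :=
  (hL s t).choose_spec x

lemma smoothGen_section (s : SmoothSections E (E × (E →L[ℝ] ℝ)) L) (x : M) :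
    SmoothGen E id (fun y => (s.1 y : GenTangent E y)) x := s.2 x

/-- Any two sections are orthogonal by isotropy, and closedness keeps brackets in `L`, hence
orthogonal to sections as well. Isotropy suffices without maximality, so this applies to a Dirac
structure and to a backward image alike. -/
lemma isLieAlgebroid_courantAlgebroid [FiniteDimensional ℝ E] (hL : CourantClosed L)
    (hsub : IsSmoothSubbundle E (E × (E →L[ℝ] ℝ)) L) (hiso : ∀ x, IsIsotropic (L x)) :
    IsLieAlgebroid (courantAlgebroid L hL) := by
  have hp : ∀ (s t : SmoothSections E (E × (E →L[ℝ] ℝ)) L) (y : M),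
      symPairing (s.1 y : GenTangent E y) (t.1 y) = 0 :=
    fun s t y => hiso y _ (s.1 y).2 _ (t.1 y).2
  have hpe : ∀ (s t : SmoothSections E (E × (E →L[ℝ] ℝ)) L) (x : M),
      ∀ᶠ y in 𝓝 x, symPairing (s.1 y : GenTangent E y) (t.1 y) = 0 :=
    fun s t x => Eventually.of_forall (hp s t)
  have hb : ∀ (s t : SmoothSections E (E × (E →L[ℝ] ℝ)) L),
      (fun x => (((courantAlgebroid L hL).bracket s t).1 x : GenTangent E x)) =
      courantBracket (fun y => (s.1 y : GenTangent E y)) (fun y => (t.1 y : GenTangent E y)) :=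
    fun s t => funext fun x => courantAlgebroid_bracket_apply hL s t x
  refine ⟨hsub, fun s x => (smoothGen_iff.1 (smoothGen_section s x)).1, fun s t u => ?_, fun c s t => ?_,
    fun s t => ?_, fun s t u => ?_, fun f hf s t ft hft x => ?_⟩
  · refine Subtype.ext (funext fun x => Subtype.ext ?_)
    refine (courantAlgebroid_bracket_apply hL s (t + u) x).trans ?_
    refine (courantBracket_add_right (smoothGen_section s x) (smoothGen_section t x) (smoothGen_section u x)
      (smoothGen_section (t + u) x) (hpe s t x) (hpe s u x) (hpe s (t + u) x)).trans ?_
    rw [← courantAlgebroid_bracket_apply hL s t x, ← courantAlgebroid_bracket_apply hL s u x]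
    rfl
  · refine Subtype.ext (funext fun x => Subtype.ext ?_)
    refine (courantAlgebroid_bracket_apply hL s (c • t) x).trans ?_
    -- A real scalar is a constant function, whose derivative term vanishes.
    refine (courantBracket_smul_right (f := fun _ => c) contMDiffAt_const (smoothGen_section s x)
      (smoothGen_section t x) (smoothGen_section (c • t) x) (hpe s t x) (hpe s (c • t) x)).trans ?_
    rw [← courantAlgebroid_bracket_apply hL s t x, dirDeriv_const, zero_smul, add_zero]
    rfl
  · refine Subtype.ext (funext fun x => Subtype.ext ?_)
    refine (courantAlgebroid_bracket_apply hL s t x).trans ?_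
    refine (courantBracket_skew _ _ (smoothGen_section s x) (smoothGen_section t x) (hpe s t x)).trans ?_
    rw [← courantAlgebroid_bracket_apply hL t s x]
    rfl
  · refine Subtype.ext (funext fun x => Subtype.ext ?_)
    refine (courantAlgebroid_bracket_apply hL s _ x).trans ?_
    rw [hb t u]
    have h1 := hp s ((courantAlgebroid L hL).bracket t u)
    have h2 := hp ((courantAlgebroid L hL).bracket s t) u
    have h3 := hp t ((courantAlgebroid L hL).bracket s u)
    simp only [courantAlgebroid_bracket_apply] at h1 h2 h3
    refine (courantBracket_jacobi (smoothGen_section s) (smoothGen_section t) (smoothGen_section u) (hp s t) (hp t u) (hp s u)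
      h1 h2 h3 x).trans ?_
    rw [← hb s t, ← hb s u, ← courantAlgebroid_bracket_apply hL, ← courantAlgebroid_bracket_apply hL]
    rfl
  · refine Subtype.ext ?_
    have e : (fun y => (ft.1 y : GenTangent E y)) = fun y => f y • (t.1 y : GenTangent E y) := by
      ext1 y
      rw [hft y]
      rfl
    refine (courantAlgebroid_bracket_apply hL s ft x).trans ?_
    have h1 := smoothGen_section ft x
    have h2 := hpe s ft x
    have h3 : ∀ y, (ft.1 y : GenTangent E y) = f y • (t.1 y : GenTangent E y) := congrFun e
    simp only [h3] at h1 h2 ⊢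
    refine (courantBracket_smul_right (hf x) (smoothGen_section s x) (smoothGen_section t x) h1 (hpe s t x) h2).trans ?_
    rw [← courantAlgebroid_bracket_apply hL s t x]
    rfl

end CourantAlgebroid

/-! ### Transport of Lie algebroid structures along isomorphisms -/

section Transport

variable {F : Type*} [NormedAddCommGroup F] [NormedSpace ℝ F]
  {V : M → Type*} [TopologicalSpace (TotalSpace F V)]
  [∀ x, AddCommGroup (V x)] [∀ x, Module ℝ (V x)] [∀ x, TopologicalSpace (V x)]
  [FiberBundle F V] [VectorBundle ℝ F V]
  {F' : Type*} [NormedAddCommGroup F'] [NormedSpace ℝ F']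
  {V' : M → Type*} [TopologicalSpace (TotalSpace F' V')]
  [∀ x, AddCommGroup (V' x)] [∀ x, Module ℝ (V' x)] [∀ x, TopologicalSpace (V' x)]
  [FiberBundle F' V'] [VectorBundle ℝ F' V']
  {A : ∀ x, Submodule ℝ (V x)} {B : ∀ x, Submodule ℝ (V' x)}

/-- The map on smooth sections induced by an isomorphism of vector bundles. -/
def SmoothSections.mapEquiv (ψ : ∀ x, A x ≃ₗ[ℝ] B x)
    (h : ∀ s : ∀ x, A x, s ∈ SmoothSections E F A ↔ (fun x => ψ x (s x)) ∈ SmoothSections E F' B) :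
    SmoothSections E F A ≃ₗ[ℝ] SmoothSections E F' B where
  toFun s := ⟨fun x => ψ x (s.1 x), (h _).1 s.2⟩
  invFun t := ⟨fun x => (ψ x).symm (t.1 x), (h _).2 (by
    simp only [LinearEquiv.apply_symm_apply]
    exact t.2)⟩
  left_inv s := Subtype.ext (funext fun x => (ψ x).symm_apply_apply _)
  right_inv t := Subtype.ext (funext fun x => (ψ x).apply_symm_apply _)
  map_add' s t := Subtype.ext (funext fun x => map_add (ψ x) _ _)
  map_smul' c s := Subtype.ext (funext fun x => map_smul (ψ x) _ _)

lemma IsLieAlgebroidIso.bracket_mapEquiv {D : AlgebroidData E F A} {D' : AlgebroidData E F' B}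
    {ψ : ∀ x, A x ≃ₗ[ℝ] B x} (hψ : IsLieAlgebroidIso D D' ψ) (s t : SmoothSections E F A) :
    D'.bracket (SmoothSections.mapEquiv ψ hψ.smooth s) (SmoothSections.mapEquiv ψ hψ.smooth t) =
      SmoothSections.mapEquiv ψ hψ.smooth (D.bracket s t) :=
  Subtype.ext (funext fun x => hψ.bracket s t _ _ (fun _ => rfl) (fun _ => rfl) x)

/-- Smooth sections correspond bijectively, so each axiom is carried over from `D`. The frame
condition on `B` is supplied separately, since it concerns how `B` sits in its ambient bundle. -/
lemma IsLieAlgebroidIso.isLieAlgebroid {D : AlgebroidData E F A} {D' : AlgebroidData E F' B}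
    {ψ : ∀ x, A x ≃ₗ[ℝ] B x} (hψ : IsLieAlgebroidIso D D' ψ) (hD : IsLieAlgebroid D)
    (hB : IsSmoothSubbundle E F' B) : IsLieAlgebroid D' := by
  set Φ := SmoothSections.mapEquiv ψ hψ.smooth with hΦ
  have hbr : ∀ s t, D'.bracket (Φ s) (Φ t) = Φ (D.bracket s t) := hψ.bracket_mapEquiv
  have hsurj : ∀ s', ∃ s, Φ s = s' := Φ.surjective
  have hΦx : ∀ s x, (Φ s).1 x = ψ x (s.1 x) := fun s x => rfl
  have hanc : ∀ s x, D'.anchor x ((Φ s).1 x) = D.anchor x (s.1 x) := fun s x => hψ.anchor x _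
  refine ⟨hB, fun s => ?_, fun s t u => ?_, fun c s t => ?_, fun s t => ?_, fun s t u => ?_,
    fun f hf s t ft hft x => ?_⟩
  · obtain ⟨s, rfl⟩ := hsurj s
    simp only [hanc]
    exact hD.anchor_smooth s
  · obtain ⟨s, rfl⟩ := hsurj s
    obtain ⟨t, rfl⟩ := hsurj t
    obtain ⟨u, rfl⟩ := hsurj u
    rw [← map_add, hbr, hbr, hbr, hD.bracket_add, map_add]
  · obtain ⟨s, rfl⟩ := hsurj s
    obtain ⟨t, rfl⟩ := hsurj t
    rw [← map_smul, hbr, hbr, hD.bracket_smul, map_smul]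
  · obtain ⟨s, rfl⟩ := hsurj s
    obtain ⟨t, rfl⟩ := hsurj t
    rw [hbr, hbr, hD.bracket_skew, map_neg]
  · obtain ⟨s, rfl⟩ := hsurj s
    obtain ⟨t, rfl⟩ := hsurj t
    obtain ⟨u, rfl⟩ := hsurj u
    simp only [hbr]
    rw [hD.jacobi, map_add]
  · obtain ⟨s, rfl⟩ := hsurj s
    obtain ⟨t, rfl⟩ := hsurj t
    obtain ⟨ft, rfl⟩ := hsurj ft
    rw [hbr, hbr, hanc, hΦx, hΦx, hΦx, ← map_smul, ← map_smul, ← map_add]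
    congr 1
    refine hD.leibniz f hf s t ft (fun y => (ψ y).injective ?_) x
    rw [map_smul]
    exact hft y

end Transport

/-! ### Local splittings of submersions -/

lemma contMDiffAt_coord_iff {F : Type*} [NormedAddCommGroup F] [NormedSpace ℝ F]
    {V : N → Type*} [TopologicalSpace (TotalSpace F V)]
    [∀ x, AddCommGroup (V x)] [∀ x, Module ℝ (V x)] [∀ x, TopologicalSpace (V x)]
    [FiberBundle F V] [VectorBundle ℝ F V] [ContMDiffVectorBundle ∞ F V 𝓘(ℝ, E')]
    (e : Trivialization F (TotalSpace.proj : TotalSpace F V → N)) [MemTrivializationAtlas e]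
    {b : M → N} {v : ∀ m, V (b m)} {x : M} (hx : b x ∈ e.baseSet)
    (hb : ContMDiffAt 𝓘(ℝ, E) 𝓘(ℝ, E') ∞ b x) :
    ContMDiffAt 𝓘(ℝ, E) (𝓘(ℝ, E').prod 𝓘(ℝ, F)) ∞ (fun m => TotalSpace.mk' F (b m) (v m)) x ↔
      ContMDiffAt 𝓘(ℝ, E) 𝓘(ℝ, F) ∞ (fun m => e.continuousLinearMapAt ℝ (b m) (v m)) x := by
  rw [e.contMDiffAt_iff (by simpa [e.mem_source] using hx)]
  have h : (fun m => (e (TotalSpace.mk' F (b m) (v m))).2) =ᶠ[𝓝 x]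
      fun m => e.continuousLinearMapAt ℝ (b m) (v m) := by
    filter_upwards [hb.continuousAt (e.open_baseSet.mem_nhds hx)] with m hm
    rw [Trivialization.continuousLinearMapAt_apply, e.coe_linearMapAt_of_mem hm]
  rw [h.contMDiffAt_iff]
  exact and_iff_right hb

lemma contMDiffAt_inverse {E₁ E₂ : Type*} [NormedAddCommGroup E₁] [NormedSpace ℝ E₁]
    [CompleteSpace E₁] [NormedAddCommGroup E₂] [NormedSpace ℝ E₂] {T : M → E₁ →L[ℝ] E₂} {x : M}
    (hT : ContMDiffAt 𝓘(ℝ, E) 𝓘(ℝ, E₁ →L[ℝ] E₂) ∞ T x) (hx : (T x).IsInvertible) :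
    ContMDiffAt 𝓘(ℝ, E) 𝓘(ℝ, E₂ →L[ℝ] E₁) ∞ (fun m => (T m).inverse) x :=
  (hx.contDiffAt_map_inverse (n := ∞)).contMDiffAt.comp x hT

lemma eventually_isInvertible {E₁ E₂ : Type*} [NormedAddCommGroup E₁] [NormedSpace ℝ E₁]
    [CompleteSpace E₁] [NormedAddCommGroup E₂] [NormedSpace ℝ E₂] {T : M → E₁ →L[ℝ] E₂} {x : M}
    (hT : ContinuousAt T x) (hx : (T x).IsInvertible) : ∀ᶠ m in 𝓝 x, (T m).IsInvertible := by
  obtain ⟨e, he⟩ := hx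
  have := hT (he ▸ e.nhds)
  exact this

/-- In finite dimensions an operator is a finite sum of rank-one operators with coefficients `T m (B
i)`. -/
lemma contMDiffAt_clm_of_basis [FiniteDimensional ℝ E'] {F : Type*} [NormedAddCommGroup F]
    [NormedSpace ℝ F] {T : M → E' →L[ℝ] F} {x : M}
    (h : ∀ v, ContMDiffAt 𝓘(ℝ, E) 𝓘(ℝ, F) ∞ (fun m => T m v) x) :
    ContMDiffAt 𝓘(ℝ, E) 𝓘(ℝ, E' →L[ℝ] F) ∞ T x := by
  let B := Module.finBasis ℝ E'
  have hT : T = fun m => ∑ i, ContinuousLinearMap.smulRightL ℝ E' F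
      (LinearMap.toContinuousLinearMap (B.coord i)) (T m (B i)) := by
    funext m
    ext v
    conv_lhs => rw [← B.sum_repr v]
    rw [map_sum]
    simp
  rw [hT]
  refine ContMDiffAt.sum fun i _ => ?_
  exact (ContinuousLinearMap.contDiff (𝕜 := ℝ) (ContinuousLinearMap.smulRightL ℝ E' F
      (LinearMap.toContinuousLinearMap (B.coord i)))).contDiffAt.contMDiffAt.comp x (h (B i))

/-- `H` is a local horizontal lift and `Z` a frame of the vertical bundle. In trivializations the
differential `A` is completed to `T = (A, Q)`, with `Q` a projection onto the kernel at `x₀`. `T` is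
invertible at `x₀`, hence nearby, and its inverse on the two factors gives `H` and `Z`. -/
lemma exists_local_splitting [FiniteDimensional ℝ E] [FiniteDimensional ℝ E'] {φ : M → N}
    (hφ : ContMDiff 𝓘(ℝ, E) 𝓘(ℝ, E') ∞ φ) (x₀ : M)
    (hs : Function.Surjective (mfderiv 𝓘(ℝ, E) 𝓘(ℝ, E') φ x₀)) :
    ∃ (r : ℕ) (H : ∀ y, TangentSpace 𝓘(ℝ, E') (φ y) → TangentSpace 𝓘(ℝ, E) y)
      (Z : Fin r → ∀ y : M, TangentSpace 𝓘(ℝ, E) y), ∀ᶠ y in 𝓝 x₀,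
      (∀ w : TangentSpace 𝓘(ℝ, E') (φ y), mfderiv 𝓘(ℝ, E) 𝓘(ℝ, E') φ y (H y w) = w) ∧
      LinearIndependent ℝ (fun i => Z i y) ∧
      Submodule.span ℝ (Set.range fun i => Z i y) =
        (mfderiv 𝓘(ℝ, E) 𝓘(ℝ, E') φ y).toLinearMap.ker ∧
      (∀ i, SmoothVec E id (Z i) y) ∧
      ∀ w : ∀ m, TangentSpace 𝓘(ℝ, E') (φ m), SmoothVec E φ w y →
        SmoothVec E id (fun m => H m (w m)) y := by
  have := FiniteDimensional.complete ℝ E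
  set e := trivializationAt E (TangentSpace 𝓘(ℝ, E) : M → Type _) x₀
  set e' := trivializationAt E' (TangentSpace 𝓘(ℝ, E') : N → Type _) (φ x₀)
  have hx : x₀ ∈ e.baseSet := mem_baseSet_trivializationAt E _ x₀
  have hx' : φ x₀ ∈ e'.baseSet := mem_baseSet_trivializationAt E' _ (φ x₀)
  let A : M → E →L[ℝ] E' := fun y => (e'.continuousLinearMapAt ℝ (φ y)).comp
    ((mfderiv 𝓘(ℝ, E) 𝓘(ℝ, E') φ y).comp (e.symmL ℝ y))
  let W := (A x₀).toLinearMap.ker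
  -- The projection onto the kernel at `x₀` stays fixed while the base point moves.
  obtain ⟨q, hq⟩ := W.subtype.exists_leftInverse_of_injective (by simp)
  let Q : E →L[ℝ] W := q.toContinuousLinearMap
  let T : M → E →L[ℝ] E' × W := fun y => (A y).prod Q
  have hA0 : Function.Surjective (A x₀) := by
    intro w
    obtain ⟨u, hu⟩ := hs (e'.symmL ℝ (φ x₀) w)
    refine ⟨e.continuousLinearMapAt ℝ x₀ u, ?_⟩
    simp only [A, ContinuousLinearMap.comp_apply]
    rw [e.symmL_continuousLinearMapAt hx, hu, e'.continuousLinearMapAt_symmL hx']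
  have hT0 : (T x₀).IsInvertible := by
    have hqw : ∀ w : W, Q w = w := fun w => congrArg (fun f => f w) hq
    have hb : Function.Bijective (T x₀).toLinearMap := by
      constructor
      · rw [injective_iff_map_eq_zero]
        intro u hu
        have h1 : A x₀ u = 0 := congrArg Prod.fst hu
        have h2 : Q u = 0 := congrArg Prod.snd hu
        have h3 := hqw ⟨u, h1⟩
        rw [h2] at h3
        exact (congrArg Subtype.val h3).symm
      · rintro ⟨w, z⟩
        obtain ⟨u, hu⟩ := hA0 w
        refine ⟨u + ((z - Q u : W) : E), ?_⟩
        have h1 : A x₀ ((z - Q u : W) : E) = 0 := (z - Q u).2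
        have h2 := hqw (z - Q u)
        exact Prod.ext ((map_add (A x₀) _ _).trans (by rw [h1, hu, add_zero]))
          ((map_add Q _ _).trans (by rw [h2]; abel))
    exact ⟨(LinearEquiv.ofBijective _ hb).toContinuousLinearEquiv, rfl⟩
  have hTs : ∀ y, y ∈ e.baseSet → φ y ∈ e'.baseSet →
      ContMDiffAt 𝓘(ℝ, E) 𝓘(ℝ, E →L[ℝ] E' × W) ∞ T y := by
    intro y hy hy'
    refine contMDiffAt_clm_of_basis fun v => ?_
    have h1 : SmoothVec E id (fun m => e.symmL ℝ m v) y := by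
      refine (contMDiffAt_coord_iff (b := id) e hy contMDiffAt_id).2 ?_
      refine (contMDiffAt_const (c := v)).congr_of_eventuallyEq ?_
      filter_upwards [e.open_baseSet.mem_nhds hy] with m hm
      exact e.continuousLinearMapAt_symmL hm v
    have h2 := (contMDiffAt_coord_iff e' hy' (hφ y)).1 (SmoothVec.mfderiv (hφ y) h1)
    exact h2.prodMk_space contMDiffAt_const
  let B := Module.finBasis ℝ W
  refine ⟨_, fun y w => e.symmL ℝ y ((T y).inverse (e'.continuousLinearMapAt ℝ (φ y) w, 0)),
    fun i y => e.symmL ℝ y ((T y).inverse (0, B i)), ?_⟩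
  filter_upwards [e.open_baseSet.mem_nhds hx,
    (hφ x₀).continuousAt (e'.open_baseSet.mem_nhds hx'),
    eventually_isInvertible (hTs x₀ hx hx').continuousAt hT0] with y hy hy' hTy
  have hy' : φ y ∈ e'.baseSet := hy'
  have hA : ∀ u : TangentSpace 𝓘(ℝ, E) y, A y (e.continuousLinearMapAt ℝ y u) =
      e'.continuousLinearMapAt ℝ (φ y) (mfderiv 𝓘(ℝ, E) 𝓘(ℝ, E') φ y u) := by
    intro u
    simp only [A, ContinuousLinearMap.comp_apply]
    rw [e.symmL_continuousLinearMapAt hy]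
  have hinj' : Function.Injective (e'.continuousLinearMapAt ℝ (φ y)) := fun a b hab => by
    have := congrArg (e'.symmL ℝ (φ y)) hab
    rwa [e'.symmL_continuousLinearMapAt hy', e'.symmL_continuousLinearMapAt hy'] at this
  have hD : ∀ p, mfderiv 𝓘(ℝ, E) 𝓘(ℝ, E') φ y (e.symmL ℝ y ((T y).inverse p)) =
      e'.symmL ℝ (φ y) p.1 := by
    intro p
    refine hinj' ?_
    rw [← hA, e.continuousLinearMapAt_symmL hy, e'.continuousLinearMapAt_symmL hy']
    exact congrArg Prod.fst (hTy.self_apply_inverse p)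
  have hinj : Function.Injective (fun w : W => e.symmL ℝ y ((T y).inverse (0, w))) := by
    intro a b hab
    have := congrArg (fun u => T y (e.continuousLinearMapAt ℝ y u)) hab
    simp only [e.continuousLinearMapAt_symmL hy, hTy.self_apply_inverse] at this
    exact congrArg Prod.snd this
  have hsm : ∀ p : M → E' × W, ContMDiffAt 𝓘(ℝ, E) 𝓘(ℝ, E' × W) ∞ p y →
      SmoothVec E id (fun m => e.symmL ℝ m ((T m).inverse (p m))) y := by
    intro p hp
    refine (contMDiffAt_coord_iff (b := id) e hy contMDiffAt_id).2 ?_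
    refine ((contMDiffAt_inverse (hTs y hy hy') hTy).clm_apply hp).congr_of_eventuallyEq ?_
    filter_upwards [e.open_baseSet.mem_nhds hy] with m hm
    exact e.continuousLinearMapAt_symmL hm _
  let j : W →ₗ[ℝ] TangentSpace 𝓘(ℝ, E) y :=
    (e.symmL ℝ y).toLinearMap ∘ₗ (T y).inverse.toLinearMap ∘ₗ LinearMap.inr ℝ E' W
  refine ⟨fun w => ?_, ?_, ?_, fun i => hsm _ contMDiffAt_const, fun w hw =>
    hsm _ (ContMDiffAt.prodMk_space ((contMDiffAt_coord_iff e' hy' (hφ y)).1 hw) contMDiffAt_const)⟩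
  · rw [hD, e'.symmL_continuousLinearMapAt hy']
  · exact B.linearIndependent.map' j (LinearMap.ker_eq_bot.2 hinj)
  · have : Set.range (fun i => e.symmL ℝ y ((T y).inverse (0, B i))) = j '' Set.range B := by
      rw [← Set.range_comp]; rfl
    rw [this, Submodule.span_image, B.span_eq]
    ext u
    simp only [Submodule.mem_map, Submodule.mem_top, true_and, LinearMap.mem_ker]
    constructor
    · rintro ⟨w, rfl⟩
      exact (hD (0, w)).trans (map_zero _)
    · intro hu
      have hu : mfderiv 𝓘(ℝ, E) 𝓘(ℝ, E') φ y u = 0 := hu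
      refine ⟨Q (e.continuousLinearMapAt ℝ y u), ?_⟩
      have h1 : T y (e.continuousLinearMapAt ℝ y u) = (0, Q (e.continuousLinearMapAt ℝ y u)) :=
        Prod.ext (by rw [← map_zero (e'.continuousLinearMapAt ℝ (φ y)), ← hu]; exact hA u) rfl
      refine (congrArg (fun p => e.symmL ℝ y ((T y).inverse p)) h1.symm).trans ?_
      show e.symmL ℝ y ((T y).inverse (T y (e.continuousLinearMapAt ℝ y u))) = u
      rw [hTy.inverse_apply_self, e.symmL_continuousLinearMapAt hy]

/-! ### Coefficients in a frame and extension of local sections -/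

section
variable {F : Type*} [NormedAddCommGroup F] [NormedSpace ℝ F]
    {V : N → Type*} [TopologicalSpace (TotalSpace F V)]
    [∀ x, AddCommGroup (V x)] [∀ x, Module ℝ (V x)] [∀ x, TopologicalSpace (V x)]
    [FiberBundle F V] [VectorBundle ℝ F V]

/-- In a trivialization the frame is a family of injections `C m`. With `l` a left inverse of `C x`,
the square matrix `D m = l ∘ C m` is the identity at `x`, so it is invertible nearby and `D⁻¹ l v`
gives smooth coefficients. -/
lemma exists_smooth_coefficients [FiniteDimensional ℝ F] [ContMDiffVectorBundle ∞ F V 𝓘(ℝ, E')] {b : M → N}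
    (hb : ContMDiff 𝓘(ℝ, E) 𝓘(ℝ, E') ∞ b) {U : Set N} (hU : IsOpen U) {r : ℕ}
    {s : Fin r → ∀ y, V y}
    (hs : ∀ i, ContMDiffOn 𝓘(ℝ, E') (𝓘(ℝ, E').prod 𝓘(ℝ, F)) ∞
      (fun y => TotalSpace.mk' F y (s i y)) U)
    {x : M} (hx : b x ∈ U) (hind : LinearIndependent ℝ (fun i => s i (b x)))
    {v : ∀ m, V (b m)}
    (hv : ContMDiff 𝓘(ℝ, E) (𝓘(ℝ, E').prod 𝓘(ℝ, F)) ∞ (fun m => TotalSpace.mk' F (b m) (v m)))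
    (hspan : ∀ m, b m ∈ U → v m ∈ Submodule.span ℝ (Set.range fun i => s i (b m))) :
    ∃ f : Fin r → M → ℝ, ∀ᶠ m in 𝓝 x,
      (∀ i, SmoothFun E (f i) m) ∧ v m = ∑ i, f i m • s i (b m) := by
  set e := trivializationAt F V (b x)
  have hxe : b x ∈ e.baseSet := mem_baseSet_trivializationAt F _ (b x)
  let C : M → (Fin r → ℝ) →L[ℝ] F := fun m =>
    ∑ i, (ContinuousLinearMap.proj i).smulRight (e.continuousLinearMapAt ℝ (b m) (s i (b m)))
  have hC : ∀ m (c : Fin r → ℝ),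
      C m c = e.continuousLinearMapAt ℝ (b m) (∑ i, c i • s i (b m)) := by
    intro m c
    simp [C, sum_apply]
  obtain ⟨l, hl⟩ : ∃ l : F →L[ℝ] (Fin r → ℝ), ∀ c, l (C x c) = c := by
    have hker : (C x).toLinearMap.ker = ⊥ := by
      rw [LinearMap.ker_eq_bot']
      intro c hc
      have hc : C x c = 0 := hc
      rw [hC] at hc
      have h1 := congrArg (e.symmL ℝ (b x)) hc
      rw [e.symmL_continuousLinearMapAt hxe, map_zero] at h1
      exact funext (Fintype.linearIndependent_iff.1 hind c h1)
    obtain ⟨l, hl⟩ := (C x).toLinearMap.exists_leftInverse_of_injective hker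
    exact ⟨l.toContinuousLinearMap,
      fun c => congrArg (fun f : (Fin r → ℝ) →ₗ[ℝ] (Fin r → ℝ) => f c) hl⟩
  let D : M → (Fin r → ℝ) →L[ℝ] (Fin r → ℝ) := fun m => l.comp (C m)
  have hDs : ∀ m, b m ∈ e.baseSet → b m ∈ U →
      ContMDiffAt 𝓘(ℝ, E) 𝓘(ℝ, (Fin r → ℝ) →L[ℝ] (Fin r → ℝ)) ∞ D m := by
    intro m hm hmU
    refine contMDiffAt_clm_of_basis fun c => ?_
    refine l.contDiff.contDiffAt.contMDiffAt.comp m ?_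
    change ContMDiffAt 𝓘(ℝ, E) 𝓘(ℝ, F) ∞ (fun y => C y c) m
    have : (fun y => C y c) = fun y => ∑ i, c i • e.continuousLinearMapAt ℝ (b y) (s i (b y)) := by
      funext y
      simp [C, sum_apply]
    rw [this]
    refine ContMDiffAt.sum fun i _ => ?_
    have h1 := (contMDiffAt_coord_iff e hm (hb m)).1
      (((hs i).contMDiffAt (hU.mem_nhds hmU)).comp m (hb m))
    have h0 : SmoothFun E (fun _ : M => c i) m := contMDiffAt_const
    exact ContMDiffAt.smul h0 h1
  have hDx : (D x).IsInvertible := by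
    have : D x = ContinuousLinearEquiv.refl ℝ (Fin r → ℝ) :=
      ContinuousLinearMap.ext fun c => hl c
    exact ⟨_, this.symm⟩
  refine ⟨fun i m => (D m).inverse (l (e.continuousLinearMapAt ℝ (b m) (v m))) i, ?_⟩
  filter_upwards [(hb x).continuousAt (e.open_baseSet.mem_nhds hxe),
    (hb x).continuousAt (hU.mem_nhds hx),
    eventually_isInvertible (hDs x hxe hx).continuousAt hDx] with m hm hmU hDm
  constructor
  · intro i
    have h1 := (contMDiffAt_inverse (hDs m hm hmU) hDm).clm_apply
      (l.contDiff.contDiffAt.contMDiffAt.comp m ((contMDiffAt_coord_iff e hm (hb m)).1 (hv m)))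
    exact contMDiffAt_pi_space.1 h1 i
  · obtain ⟨c, hc⟩ := (Submodule.mem_span_range_iff_exists_fun ℝ).1 (hspan m hmU)
    have h1 : l (e.continuousLinearMapAt ℝ (b m) (v m)) = D m c := by
      rw [← hc, ← hC]; rfl
    rw [h1, hDm.inverse_apply_self]
    exact hc.symm

/-- Multiplication by a bump function supported in `U` extends by zero, and zero lies in every `A
y`. -/
lemma exists_smoothSection_eventuallyEq [FiniteDimensional ℝ E'] [T2Space N]
    {A : ∀ y, Submodule ℝ (V y)}
    {U : Set N} (hU : IsOpen U) {y₀ : N} (hy : y₀ ∈ U) {s : ∀ y, V y}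
    (hs : ContMDiffOn 𝓘(ℝ, E') (𝓘(ℝ, E').prod 𝓘(ℝ, F)) ∞ (fun y => TotalSpace.mk' F y (s y)) U)
    (hA : ∀ y ∈ U, s y ∈ A y) :
    ∃ α : SmoothSections E' F A, ∀ᶠ y in 𝓝 y₀, (α.1 y : V y) = s y := by
  obtain ⟨χ, -, hχ⟩ := (SmoothBumpFunction.nhds_basis_tsupport (I := 𝓘(ℝ, E')) y₀).mem_iff.1
    (hU.mem_nhds hy)
  refine ⟨⟨fun y => ⟨χ y • s y, ?_⟩, ?_⟩, ?_⟩
  · by_cases h : y ∈ U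
    · exact (A y).smul_mem _ (hA y h)
    · rw [image_eq_zero_of_notMem_tsupport fun h' => h (hχ h'), zero_smul]
      exact (A y).zero_mem
  · exact ContMDiffOn.smul_section_of_tsupport χ.contMDiff.contMDiffOn hU hχ hs
  · filter_upwards [χ.eventuallyEq_one] with y hy
    simp [hy]

lemma exists_contMDiff_eventuallyEq [FiniteDimensional ℝ E] [T2Space M] {f : M → ℝ} {x : M}
    (hf : ∀ᶠ m in 𝓝 x, SmoothFun E f m) :
    ∃ g : M → ℝ, ContMDiff 𝓘(ℝ, E) 𝓘(ℝ, ℝ) ∞ g ∧ g =ᶠ[𝓝 x] f := by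
  obtain ⟨χ, -, hχ⟩ := (SmoothBumpFunction.nhds_basis_tsupport (I := 𝓘(ℝ, E)) x).mem_iff.1 hf
  refine ⟨fun m => χ m * f m, contMDiff_of_tsupport fun m hm => ?_, ?_⟩
  · exact χ.contMDiffAt.mul (hχ (tsupport_mul_subset_left hm))
  · filter_upwards [χ.eventuallyEq_one] with y hy
    simp [hy]

/-- The finite sums in the definition of the pullback bracket use global functions and global
sections; this provides them near every point. -/
lemma exists_local_representation [FiniteDimensional ℝ F] [FiniteDimensional ℝ E] [T2Space M] [FiniteDimensional ℝ E']
    [T2Space N] [ContMDiffVectorBundle ∞ F V 𝓘(ℝ, E')] {A : ∀ y, Submodule ℝ (V y)}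
    (hA : IsSmoothSubbundle E' F A) {b : M → N} (hb : ContMDiff 𝓘(ℝ, E) 𝓘(ℝ, E') ∞ b)
    {v : ∀ m, V (b m)}
    (hv : ContMDiff 𝓘(ℝ, E) (𝓘(ℝ, E').prod 𝓘(ℝ, F)) ∞ (fun m => TotalSpace.mk' F (b m) (v m)))
    (hvA : ∀ m, v m ∈ A (b m)) (x : M) :
    ∃ (r : ℕ) (f : Fin r → M → ℝ) (α : Fin r → SmoothSections E' F A),
      (∀ i, ContMDiff 𝓘(ℝ, E) 𝓘(ℝ, ℝ) ∞ (f i)) ∧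
      ∀ᶠ m in 𝓝 x, v m = ∑ i, f i m • ((α i).1 (b m) : V (b m)) := by
  obtain ⟨U, hU, hx, r, s, hs, hsA⟩ := hA (b x)
  obtain ⟨f, hf⟩ := exists_smooth_coefficients hb hU hs hx (hsA _ hx).1 hv
    fun m hm => (hsA _ hm).2 ▸ hvA m
  choose g hg hgf using fun i =>
    exists_contMDiff_eventuallyEq (hf.mono fun m h => h.1 i : ∀ᶠ m in 𝓝 x, SmoothFun E (f i) m)
  choose α hα using fun i => exists_smoothSection_eventuallyEq (A := A) hU hx (hs i)
    fun y hy => (hsA y hy).2 ▸ Submodule.subset_span ⟨i, rfl⟩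
  refine ⟨r, g, α, hg, ?_⟩
  filter_upwards [hf, eventually_all.2 hgf,
    (hb x).continuousAt.eventually (eventually_all.2 hα)] with m h1 h2 h3
  rw [h1.2]
  exact Finset.sum_congr rfl fun i _ => by rw [h2 i, h3 i]

lemma contMDiffAt_pullbackAmbient_iff {φ : C^∞⟮𝓘(ℝ, E), M; 𝓘(ℝ, E'), N⟯}
    {p : ∀ m, PullbackAmbient φ V m} {x : M} [ContMDiffVectorBundle ∞ F V 𝓘(ℝ, E')] :
    ContMDiffAt 𝓘(ℝ, E) (𝓘(ℝ, E).prod 𝓘(ℝ, E × F)) ∞ (fun m => TotalSpace.mk' (E × F) m (p m)) x ↔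
      SmoothVec E id (fun m => (p m).1) x ∧
      ContMDiffAt 𝓘(ℝ, E) (𝓘(ℝ, E').prod 𝓘(ℝ, F)) ∞
        (fun m => TotalSpace.mk' F (E := V) (φ m) (p m).2) x := by
  simp only [SmoothVec, contMDiffAt_totalSpace]
  have h1 : ∀ (f : M → E) (g : M → F), ContMDiffAt 𝓘(ℝ, E) 𝓘(ℝ, E × F) ∞ (fun m => (f m, g m)) x ↔
      ContMDiffAt 𝓘(ℝ, E) 𝓘(ℝ, E) ∞ f x ∧ ContMDiffAt 𝓘(ℝ, E) 𝓘(ℝ, F) ∞ g x := fun f g =>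
    contMDiffAt_prod_module_iff (fun m => (f m, g m))
  have h2 : ContMDiffAt 𝓘(ℝ, E) 𝓘(ℝ, E') ∞ (fun m => φ m) x := φ.contMDiff x
  have h3 : ContMDiffAt 𝓘(ℝ, E) 𝓘(ℝ, E) ∞ (fun m : M => m) x := contMDiffAt_id
  refine Iff.trans (and_congr_right fun _ => h1 _ _) ?_
  refine Iff.trans ⟨fun h => ⟨⟨h.1, h.2.1⟩, h2, h.2.2⟩, fun h => ⟨h.1.1, h.1.2, h.2.2⟩⟩ Iff.rfl

end

/-! ### The Courant bracket of sections related through a map -/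

lemma dirDeriv_comp_of_mdifferentiableAt {φ : M → N} {x : M} {q : N → ℝ}
    (hφ : MDifferentiableAt 𝓘(ℝ, E) 𝓘(ℝ, E') φ x)
    (hq : MDifferentiableAt 𝓘(ℝ, E') 𝓘(ℝ, ℝ) q (φ x)) (v : TangentSpace 𝓘(ℝ, E) x) :
    dirDeriv (fun y => q (φ y)) x v = dirDeriv q (φ x) (mfderiv 𝓘(ℝ, E) 𝓘(ℝ, E') φ x v) := by
  have := mfderiv_comp x hq hφ
  unfold dirDeriv
  erw [this]
  rfl

/-- The component along `N` of the bracket of the sections `(X, ∑ i, f i ⊗ α i)` and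
`(Y, ∑ j, g j ⊗ β j)` of a pullback along `φ`. -/
def pullbackBracket {φ : M → N} {ι κ : Type*} [Fintype ι] [Fintype κ] (f : ι → M → ℝ) (g : κ → M → ℝ)
    (α : ι → ∀ y : N, GenTangent E' y) (β : κ → ∀ y : N, GenTangent E' y) (x : M)
    (X Y : TangentSpace 𝓘(ℝ, E) x) : GenTangent E' (φ x) :=
  ∑ i, ∑ j, (f i x * g j x) • courantBracket (α i) (β j) (φ x) +
    ∑ j, dirDeriv (g j) x X • β j (φ x) - ∑ i, dirDeriv (f i) x Y • α i (φ x)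

section Key

variable {φ : M → N} {ι κ : Type*} [Fintype ι] [Fintype κ] {f : ι → M → ℝ} {g : κ → M → ℝ}
  {α : ι → ∀ y : N, GenTangent E' y} {β : κ → ∀ y : N, GenTangent E' y} {x : M}

lemma pullbackBracket_fst (X Y : TangentSpace 𝓘(ℝ, E) x) :
    (pullbackBracket (φ := φ) f g α β x X Y).1 =
      ∑ i, ∑ j, (f i x * g j x) • VectorField.mlieBracket 𝓘(ℝ, E') (fun y => (α i y).1)
        (fun y => (β j y).1) (φ x) +
      ∑ j, dirDeriv (g j) x X • (β j (φ x)).1 - ∑ i, dirDeriv (f i) x Y • (α i (φ x)).1 := by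
  let p : GenTangent E' (φ x) →ₗ[ℝ] TangentSpace 𝓘(ℝ, E') (φ x) := LinearMap.fst ℝ _ _
  change p (pullbackBracket (φ := φ) f g α β x X Y) = _
  unfold pullbackBracket
  simp only [map_sub, map_add, map_sum, map_smul]
  rfl

lemma pullbackBracket_snd_apply (X Y : TangentSpace 𝓘(ℝ, E) x) (w : TangentSpace 𝓘(ℝ, E') (φ x)) :
    ((pullbackBracket (φ := φ) f g α β x X Y).2 w : ℝ) =
      ∑ i, ∑ j, f i x * g j x * (courantBracket (α i) (β j) (φ x)).2 w +
      ∑ j, dirDeriv (g j) x X * (β j (φ x)).2 w - ∑ i, dirDeriv (f i) x Y * (α i (φ x)).2 w := by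
  let p : GenTangent E' (φ x) →ₗ[ℝ] ℝ :=
    { toFun := fun q => q.2 w, map_add' := fun _ _ => rfl, map_smul' := fun _ _ => rfl }
  change p (pullbackBracket (φ := φ) f g α β x X Y) = _
  unfold pullbackBracket
  simp only [map_sub, map_add, map_sum, map_smul]
  rfl

/-- In the application `c i j` is `α i` evaluated on the vector part of `β j`, `dc` its derivative,
`D` and `D'` come from the exterior derivatives of `β j` and `α i`, and `Uf`, `Ug` are derivatives
along the test vector. The latter must disappear: they enter the first two sums with `∓c` and are
cancelled by the product rule in the third. -/
lemma bracket_sum_identity (f Yf a Uf : ι → ℝ) (g Xg b Ug : κ → ℝ) (c D D' dc : ι → κ → ℝ) :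
    (∑ j, (Xg j * b j - Ug j * (∑ i, f i * (- c i j)) + g j * ∑ i, f i * D i j)) -
      (∑ i, (Yf i * a i - Uf i * (∑ j, g j * c i j) + f i * ∑ j, g j * D' i j)) +
      (∑ i, ∑ j, (f i * g j * dc i j + c i j * (f i * Ug j + g j * Uf i))) * (-1) =
    ∑ i, ∑ j, f i * g j * (D i j - D' i j + dc i j * (-1)) + ∑ j, Xg j * b j - ∑ i, Yf i * a i := by
  have h1 : ∑ j, (Xg j * b j - Ug j * (∑ i, f i * (- c i j)) + g j * ∑ i, f i * D i j) =
      ∑ j, Xg j * b j + ∑ i, ∑ j, (Ug j * f i * c i j + g j * f i * D i j) := by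
    rw [Finset.sum_comm, ← Finset.sum_add_distrib]
    refine Finset.sum_congr rfl fun j _ => ?_
    rw [Finset.mul_sum, Finset.mul_sum, sub_eq_add_neg, ← Finset.sum_neg_distrib, add_assoc,
      ← Finset.sum_add_distrib]
    congr 1
    exact Finset.sum_congr rfl fun i _ => by ring
  have h2 : ∑ i, (Yf i * a i - Uf i * (∑ j, g j * c i j) + f i * ∑ j, g j * D' i j) =
      ∑ i, Yf i * a i + ∑ i, ∑ j, (- (Uf i * g j * c i j) + f i * g j * D' i j) := by
    rw [← Finset.sum_add_distrib]
    refine Finset.sum_congr rfl fun i _ => ?_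
    rw [Finset.mul_sum, Finset.mul_sum, sub_eq_add_neg, ← Finset.sum_neg_distrib, add_assoc,
      ← Finset.sum_add_distrib]
    congr 1
    exact Finset.sum_congr rfl fun i _ => by ring
  have h3 : ∑ i, ∑ j, f i * g j * (D i j - D' i j + dc i j * (-1)) =
      ∑ i, ∑ j, (Ug j * f i * c i j + g j * f i * D i j) -
      ∑ i, ∑ j, (- (Uf i * g j * c i j) + f i * g j * D' i j) +
      (∑ i, ∑ j, (f i * g j * dc i j + c i j * (f i * Ug j + g j * Uf i))) * (-1) := by
    simp only [Finset.sum_mul, ← Finset.sum_add_distrib, ← Finset.sum_sub_distrib]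
    exact Finset.sum_congr rfl fun i _ => Finset.sum_congr rfl fun j _ => by ring
  rw [h1, h2, h3]
  ring

variable [FiniteDimensional ℝ E] [FiniteDimensional ℝ E']

/-- Differentiating `Y(q ∘ φ) = ∑ g j · (B j q) ∘ φ` along `v` produces the terms with derivatives
of `g j` that appear in the bracket formula. -/
lemma dirDeriv_dirDeriv_comp (hφ : ContMDiff 𝓘(ℝ, E) 𝓘(ℝ, E') ∞ φ) {q : N → ℝ}
    (hq : SmoothFun E' q (φ x)) {v : TangentSpace 𝓘(ℝ, E) x} {Y : ∀ m : M, TangentSpace 𝓘(ℝ, E) m}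
    {c : ι → ℝ} {A : ι → TangentSpace 𝓘(ℝ, E') (φ x)} {B : κ → ∀ y : N, TangentSpace 𝓘(ℝ, E') y}
    (hg : ∀ j, SmoothFun E (g j) x) (hB : ∀ j, SmoothVec E' id (B j) (φ x))
    (hv : mfderiv 𝓘(ℝ, E) 𝓘(ℝ, E') φ x v = ∑ i, c i • A i)
    (hY : ∀ᶠ m in 𝓝 x, mfderiv 𝓘(ℝ, E) 𝓘(ℝ, E') φ m (Y m) = ∑ j, g j m • B j (φ m)) :
    dirDeriv (fun m => dirDeriv (fun y => q (φ y)) m (Y m)) x v =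
      ∑ j, (g j x * ∑ i, c i * dirDeriv (fun y => dirDeriv q y (B j y)) (φ x) (A i) +
        dirDeriv q (φ x) (B j (φ x)) * dirDeriv (g j) x v) := by
  have h1 : (fun m => dirDeriv (fun y => q (φ y)) m (Y m)) =ᶠ[𝓝 x]
      fun m => ∑ j, g j m * dirDeriv q (φ m) (B j (φ m)) := by
    filter_upwards [hY, (hφ x).continuousAt.eventually hq.eventually_mdiff] with m hm hqm
    rw [dirDeriv_comp_of_mdifferentiableAt ((hφ m).mdifferentiableAt (by simp)) hqm, hm]
    simp
  have hBs : ∀ j, SmoothFun E' (fun y => dirDeriv q y (B j y)) (φ x) := fun j => hq.dirDeriv (hB j)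
  have hBc : ∀ j, SmoothFun E (fun m => dirDeriv q (φ m) (B j (φ m))) x :=
    fun j => (hBs j).comp x (hφ x)
  rw [dirDeriv_congr h1, dirDeriv_sum _ fun j _ => (hg j).mul (hBc j)]
  refine Finset.sum_congr rfl fun j _ => ?_
  rw [dirDeriv_mul (hg j) (hBc j)]
  rw [dirDeriv_comp (q := fun y => dirDeriv q y (B j y)) (hφ x) (hBs j), hv]
  simp

/-- The central computation. The vector parts are compared as derivations of functions on `N`. For
the covector parts `d` commutes with `φ^*`, so only derivatives of the coefficients remain; those
along the test vector cancel by isotropy, and those along `X` and `Y` are the extra terms of the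
formula. -/
theorem courantBracket_pullback (hφ : ContMDiff 𝓘(ℝ, E) 𝓘(ℝ, E') ∞ φ)
    {σ τ : ∀ m : M, GenTangent E m} (hσ : SmoothGen E id σ x) (hτ : SmoothGen E id τ x)
    (hf : ∀ i, SmoothFun E (f i) x) (hg : ∀ j, SmoothFun E (g j) x)
    (hα : ∀ i, SmoothGen E' id (α i) (φ x)) (hβ : ∀ j, SmoothGen E' id (β j) (φ x))
    (hiso : ∀ i j, ∀ᶠ y in 𝓝 (φ x), symPairing (α i y) (β j y) = 0)
    (hiso' : ∀ᶠ m in 𝓝 x, symPairing (σ m) (τ m) = 0)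
    (hσ1 : ∀ᶠ m in 𝓝 x, mfderiv 𝓘(ℝ, E) 𝓘(ℝ, E') φ m (σ m).1 = ∑ i, f i m • (α i (φ m)).1)
    (hσ2 : ∀ᶠ m in 𝓝 x, (σ m).2 = ∑ i, f i m • pullbackCovector (E := E) φ m (α i (φ m)).2)
    (hτ1 : ∀ᶠ m in 𝓝 x, mfderiv 𝓘(ℝ, E) 𝓘(ℝ, E') φ m (τ m).1 = ∑ j, g j m • (β j (φ m)).1)
    (hτ2 : ∀ᶠ m in 𝓝 x, (τ m).2 = ∑ j, g j m • pullbackCovector (E := E) φ m (β j (φ m)).2) :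
    mfderiv 𝓘(ℝ, E) 𝓘(ℝ, E') φ x (courantBracket σ τ x).1 =
        (pullbackBracket (φ := φ) f g α β x (σ x).1 (τ x).1).1 ∧
      (courantBracket σ τ x).2 = pullbackCovector (E := E) φ x
        (pullbackBracket (φ := φ) f g α β x (σ x).1 (τ x).1).2 := by
  have : CompleteSpace E := FiniteDimensional.complete ℝ E
  have : CompleteSpace E' := FiniteDimensional.complete ℝ E'
  have hσs := smoothGen_iff.1 hσ
  have hτs := smoothGen_iff.1 hτ
  have hαs := fun i => smoothGen_iff.1 (hα i)
  have hβs := fun j => smoothGen_iff.1 (hβ j)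
  constructor
  · rw [pullbackBracket_fst]
    refine tangent_eq_of_dirDeriv_eq fun q hq => ?_
    have hqφ : SmoothFun E (fun m => q (φ m)) x := hq.comp x (hφ x)
    rw [← dirDeriv_comp (hφ x) hq]
    refine (dirDeriv_mlieBracket hqφ hσs.1 hτs.1).trans ?_
    rw [dirDeriv_dirDeriv_comp (Y := fun m => (τ m).1) hφ hq hg (fun j => (hβs j).1)
        hσ1.self_of_nhds hτ1,
      dirDeriv_dirDeriv_comp (Y := fun m => (σ m).1) hφ hq hf (fun j => (hαs j).1)
        hτ1.self_of_nhds hσ1]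
    simp only [dirDeriv_vec_sub, dirDeriv_vec_add, dirDeriv_vec_sum, dirDeriv_vec_smul]
    simp only [dirDeriv_mlieBracket hq (hαs _).1 (hβs _).1, Finset.sum_add_distrib, Finset.mul_sum]
    simp only [mul_sub, Finset.sum_sub_distrib]
    rw [Finset.sum_comm]
    have e1 : ∀ i j (t : ℝ), g j x * (f i x * t) = f i x * g j x * t := fun i j t => by ring
    have e2 : ∀ i j (t : ℝ), f i x * (g j x * t) = f i x * g j x * t := fun i j t => by ring
    simp only [e1, e2, mul_comm (dirDeriv q (φ x) _)]
    ring
  · ext u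
    set w := mfderiv 𝓘(ℝ, E) 𝓘(ℝ, E') φ x u
    have hpc : ∀ (γ : ∀ y : N, GenTangent E' y), SmoothGen E' id γ (φ x) →
        SmoothCov E id (fun m => pullbackCovector (E := E) φ m (γ (φ m)).2) x := by
      intro γ hγ
      refine smoothCov_of_apply contMDiffAt_id fun W hW => ?_
      have h1 : SmoothCov E φ (fun m => (γ (φ m)).2) x :=
        ContMDiffAt.comp x (smoothGen_iff.1 hγ).2 (hφ x)
      exact h1.apply (SmoothVec.mfderiv (hφ x) hW.self_of_nhds)
    have hc : ∀ i j, SmoothFun E' (fun y => ((α i y).2 (β j y).1 : ℝ)) (φ x) :=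
      fun i j => (hαs i).2.apply (hβs j).1
    -- Isotropy on `N` supplies the sign on which the cancellation depends.
    have hcx : ∀ i j, ((β j (φ x)).2 (α i (φ x)).1 : ℝ) = - (α i (φ x)).2 (β j (φ x)).1 := by
      intro i j
      have := (hiso i j).self_of_nhds
      unfold symPairing at this
      linarith
    have hcc : ∀ i j, SmoothFun E (fun m => ((α i (φ m)).2 (β j (φ m)).1 : ℝ)) x :=
      fun i j => (hc i j).comp x (hφ x)
    have hpair : (fun m => ((σ m).2 (τ m).1 : ℝ)) =ᶠ[𝓝 x]
        fun m => ∑ i, ∑ j, f i m * g j m * (α i (φ m)).2 (β j (φ m)).1 := by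
      filter_upwards [hσ2, hτ1] with m h1 h2
      rw [h1]
      refine (sum_apply _ _ _).trans (Finset.sum_congr rfl fun i _ => ?_)
      change f i m * (α i (φ m)).2 (mfderiv 𝓘(ℝ, E) 𝓘(ℝ, E') φ m (τ m).1) = _
      rw [h2, map_sum, Finset.mul_sum]
      refine Finset.sum_congr rfl fun j _ => ?_
      rw [map_smul, smul_eq_mul, mul_assoc]
    have hd : ∀ i j, dirDeriv (fun m => f i m * g j m * (α i (φ m)).2 (β j (φ m)).1) x u =
        f i x * g j x * dirDeriv (fun y => ((α i y).2 (β j y).1 : ℝ)) (φ x) w +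
          (α i (φ x)).2 (β j (φ x)).1 *
            (f i x * dirDeriv (g j) x u + g j x * dirDeriv (f i) x u) := by
      intro i j
      rw [dirDeriv_mul ((hf i).mul (hg j)) (hcc i j), dirDeriv_mul (hf i) (hg j),
        dirDeriv_comp (q := fun y => ((α i y).2 (β j y).1 : ℝ)) (hφ x) (hc i j)]
    have hw : ∀ γ : Cotangent E' (φ x), (pullbackCovector (E := E) φ x γ u : ℝ) = γ w :=
      fun _ => rfl
    have hs1 : ∀ i, oneFormDeriv (fun m => pullbackCovector (E := E) φ m (α i (φ m)).2) x
        (τ x).1 u = ∑ j, g j x * oneFormDeriv (fun y => (α i y).2) (φ x) (β j (φ x)).1 w := by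
      intro i
      rw [oneFormDeriv_pullback (β := fun y => (α i y).2) (hφ x) (hαs i).2, hτ1.self_of_nhds,
        map_sum, sum_apply]
      exact Finset.sum_congr rfl fun j _ => by rw [map_smul]; rfl
    have hs2 : ∀ j, oneFormDeriv (fun m => pullbackCovector (E := E) φ m (β j (φ m)).2) x
        (σ x).1 u = ∑ i, f i x * oneFormDeriv (fun y => (β j y).2) (φ x) (α i (φ x)).1 w := by
      intro j
      rw [oneFormDeriv_pullback (β := fun y => (β j y).2) (hφ x) (hβs j).2, hσ1.self_of_nhds,
        map_sum, sum_apply]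
      exact Finset.sum_congr rfl fun j _ => by rw [map_smul]; rfl
    have ht1 : ∀ i, (pullbackCovector (E := E) φ x (α i (φ x)).2 (τ x).1 : ℝ) =
        ∑ j, g j x * (α i (φ x)).2 (β j (φ x)).1 := by
      intro i
      change (α i (φ x)).2 (mfderiv 𝓘(ℝ, E) 𝓘(ℝ, E') φ x (τ x).1) = _
      rw [hτ1.self_of_nhds, map_sum]
      exact Finset.sum_congr rfl fun j _ => by rw [map_smul]; rfl
    have ht2 : ∀ j, (pullbackCovector (E := E) φ x (β j (φ x)).2 (σ x).1 : ℝ) =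
        ∑ i, f i x * - (α i (φ x)).2 (β j (φ x)).1 := by
      intro j
      change (β j (φ x)).2 (mfderiv 𝓘(ℝ, E) 𝓘(ℝ, E') φ x (σ x).1) = _
      rw [hσ1.self_of_nhds, map_sum]
      exact Finset.sum_congr rfl fun i _ => by rw [map_smul, hcx]; rfl
    have hd' : dirDeriv (fun m => ((σ m).2 (τ m).1 : ℝ)) x u =
        ∑ i, ∑ j, (f i x * g j x * dirDeriv (fun y => ((α i y).2 (β j y).1 : ℝ)) (φ x) w +
          (α i (φ x)).2 (β j (φ x)).1 *
            (f i x * dirDeriv (g j) x u + g j x * dirDeriv (f i) x u)) := by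
      rw [dirDeriv_congr hpair,
        dirDeriv_sum _ fun i _ => SmoothFun.sum fun j _ => ((hf i).mul (hg j)).mul (hcc i j)]
      refine Finset.sum_congr rfl fun i _ => ?_
      rw [dirDeriv_sum _ fun j _ => ((hf i).mul (hg j)).mul (hcc i j)]
      exact Finset.sum_congr rfl fun j _ => hd i j
    rw [courantBracket_snd_apply hσ hτ hiso',
      oneFormDeriv_sum_smul hg (fun j => hpc _ (hβ j)) hτs.2 hτ2,
      oneFormDeriv_sum_smul hf (fun i => hpc _ (hα i)) hσs.2 hσ2, hd', hw,
      pullbackBracket_snd_apply]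
    simp only [hs1, hs2, ht1, ht2, hw,
      fun i j => courantBracket_snd_apply (hα i) (hβ j) (hiso i j)]
    exact bracket_sum_identity _ _ _ _ _ _ _ _ _ _ _ _

end Key

/-! ### Comparing the pullback bundle with the backward image -/

lemma SmoothCov.pullback [FiniteDimensional ℝ E] {φ : M → N} {x : M}
    (hφ : ContMDiffAt 𝓘(ℝ, E) 𝓘(ℝ, E') ∞ φ x) {β : ∀ m, Cotangent E' (φ m)}
    (hβ : SmoothCov E φ β x) :
    SmoothCov E id (fun m => pullbackCovector (E := E) φ m (β m)) x :=
  smoothCov_of_apply contMDiffAt_id fun _ hW => hβ.apply (SmoothVec.mfderiv hφ hW.self_of_nhds)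

/-- With a smooth horizontal lift `H`, the values of `β` are recovered as `β(W) = (φ^*β)(H W)`. -/
lemma SmoothCov.of_pullback [FiniteDimensional ℝ E] [FiniteDimensional ℝ E'] {φ : M → N}
    (hφ : ContMDiff 𝓘(ℝ, E) 𝓘(ℝ, E') ∞ φ) {x : M}
    (hs : Function.Surjective (mfderiv 𝓘(ℝ, E) 𝓘(ℝ, E') φ x)) {β : ∀ m, Cotangent E' (φ m)}
    (hβ : SmoothCov E id (fun m => pullbackCovector (E := E) φ m (β m)) x) :
    SmoothCov E φ β x := by
  obtain ⟨r, H, Z, hH⟩ := exists_local_splitting hφ x hs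
  refine smoothCov_of_apply (hφ x) fun W hW => ?_
  have h1 : SmoothVec E φ (fun m => W (φ m)) x := ContMDiffAt.comp x hW.self_of_nhds (hφ x)
  refine (hβ.apply (hH.self_of_nhds.2.2.2.2 _ h1)).congr_of_eventuallyEq ?_
  filter_upwards [hH] with m hm
  exact congrArg (β m) (hm.1 _).symm

lemma pullbackCovector_injective {φ : M → N} {x : M}
    (hs : Function.Surjective (mfderiv 𝓘(ℝ, E) 𝓘(ℝ, E') φ x)) :
    Function.Injective (pullbackCovector (E := E) (E' := E') φ x) := by
  intro α β h
  ext w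
  obtain ⟨u, rfl⟩ := hs w
  exact congrArg (fun γ : Cotangent E x => (γ u : ℝ)) h

/-- The pairing of `X + φ^*α` with `Y + φ^*β` is by definition that of `φ_*X + α` with `φ_*Y + β`.
-/
lemma isIsotropic_backwardImage {φ : M → N} {K : ∀ y : N, Submodule ℝ (GenTangent E' y)} {x : M}
    (hK : IsIsotropic (K (φ x))) : IsIsotropic (backwardImage (E := E) φ K x) := by
  rintro ⟨X, a⟩ ⟨α, hα, hα'⟩ ⟨Y, b⟩ ⟨β, hβ, hβ'⟩
  obtain rfl : a = _ := hα
  obtain rfl : b = _ := hβ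
  exact hK _ hα' _ hβ'

section PullbackSubbundle

variable (φ : C^∞⟮𝓘(ℝ, E), M; 𝓘(ℝ, E'), N⟯)

/-- The linear map `(X, Y + α) ↦ X + φ^* α`. -/
def pullbackToGen (x : M) : PullbackAmbient φ (GenTangent E') x →ₗ[ℝ] GenTangent E x where
  toFun p := (p.1, pullbackCovector (E := E) φ x (p.2 : GenTangent E' (φ x)).2)
  map_add' _ _ := rfl
  map_smul' _ _ := rfl

variable {φ} {K : ∀ y : N, Submodule ℝ (GenTangent E' y)} {hK : CourantClosed K}

lemma mem_pullbackFiber_iff {x : M} {p : PullbackAmbient φ (GenTangent E') x} :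
    p ∈ pullbackFiber φ (courantAlgebroid K hK) x ↔
      (p.2 : GenTangent E' (φ x)) ∈ K (φ x) ∧
        (p.2 : GenTangent E' (φ x)).1 = mfderiv 𝓘(ℝ, E) 𝓘(ℝ, E') φ x p.1 := by
  constructor
  · rintro ⟨v, hv, hv'⟩
    have hv : (v : GenTangent E' (φ x)) = p.2 := hv
    exact ⟨hv ▸ v.2, hv ▸ hv'⟩
  · rintro ⟨h1, h2⟩
    exact ⟨⟨_, h1⟩, rfl, h2⟩

lemma map_pullbackToGen (x : M) :
    (pullbackFiber φ (courantAlgebroid K hK) x).map (pullbackToGen φ x) =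
      backwardImage (E := E) φ K x := by
  ext p
  constructor
  · rintro ⟨⟨X, v⟩, hp, rfl⟩
    obtain ⟨h1, h2⟩ := mem_pullbackFiber_iff.1 hp
    refine ⟨(v : GenTangent E' (φ x)).2, rfl, ?_⟩
    have : ((mfderiv 𝓘(ℝ, E) 𝓘(ℝ, E') φ x X, (v : GenTangent E' (φ x)).2) :
      GenTangent E' (φ x)) = v := Prod.ext h2.symm rfl
    exact this ▸ h1
  · rintro ⟨α, hα, h⟩
    refine ⟨(p.1, ((mfderiv 𝓘(ℝ, E) 𝓘(ℝ, E') φ x p.1, α) : GenTangent E' (φ x))),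
      mem_pullbackFiber_iff.2 ⟨h, rfl⟩, Prod.ext rfl hα.symm⟩

lemma pullbackToGen_injOn {x : M} (hs : Function.Surjective (mfderiv 𝓘(ℝ, E) 𝓘(ℝ, E') φ x)) :
    ∀ p ∈ pullbackFiber φ (courantAlgebroid K hK) x, pullbackToGen φ x p = 0 → p = 0 := by
  rintro ⟨X, v⟩ hp h
  obtain ⟨h1, h2⟩ := mem_pullbackFiber_iff.1 hp
  have hX : X = 0 := congrArg Prod.fst h
  have hv : (v : GenTangent E' (φ x)).2 = 0 :=
    pullbackCovector_injective hs (congrArg Prod.snd h)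
  subst hX
  refine Prod.ext rfl ?_
  have : (v : GenTangent E' (φ x)) = 0 := Prod.ext (h2.trans (map_zero _)) hv
  exact this

/-- The vector part over `N`, which `pullbackToGen` forgets, is `φ_*X` and hence smooth with `X`;
the covector part is recovered through a horizontal lift. The equivalence makes the bundle
isomorphism smooth in both directions. -/
lemma contMDiffAt_pullbackToGen_iff [FiniteDimensional ℝ E] [FiniteDimensional ℝ E'] {x : M}
    (hs : Function.Surjective (mfderiv 𝓘(ℝ, E) 𝓘(ℝ, E') φ x))
    {p : ∀ m, PullbackAmbient φ (GenTangent E') m}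
    (hp : ∀ᶠ m in 𝓝 x, (p m).2.1 = mfderiv 𝓘(ℝ, E) 𝓘(ℝ, E') φ m (p m).1) :
    ContMDiffAt 𝓘(ℝ, E) (𝓘(ℝ, E).prod 𝓘(ℝ, E × (E' × (E' →L[ℝ] ℝ)))) ∞
        (fun m => TotalSpace.mk' (E × (E' × (E' →L[ℝ] ℝ))) m (p m)) x ↔
      SmoothGen E id (fun m => pullbackToGen φ m (p m)) x := by
  rw [contMDiffAt_pullbackAmbient_iff, smoothGen_iff]
  refine Iff.trans (and_congr_right' (smoothGen_iff (s := fun m => (p m).2))) ?_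
  constructor
  · rintro ⟨h1, h2, h3⟩
    exact ⟨h1, h3.pullback (φ.contMDiff x)⟩
  · rintro ⟨h1, h2⟩
    refine ⟨h1, ?_, SmoothCov.of_pullback φ.contMDiff hs h2⟩
    refine (SmoothVec.mfderiv (φ.contMDiff x) h1).congr_of_eventuallyEq ?_
    filter_upwards [hp] with m hm
    exact congrArg (TotalSpace.mk' E' (E := fun y : N => TangentSpace 𝓘(ℝ, E') y) (φ m)) hm

end PullbackSubbundle

/-! ### Smooth frames and the bundle isomorphism -/

/-- The projection of `TM ⊕ φ^! 𝕋 N` to `TM`. -/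
def pullbackAmbientFst (φ : C^∞⟮𝓘(ℝ, E), M; 𝓘(ℝ, E'), N⟯) (x : M) :
    PullbackAmbient φ (GenTangent E') x →ₗ[ℝ] TangentSpace 𝓘(ℝ, E) x where
  toFun p := p.1
  map_add' _ _ := rfl
  map_smul' _ _ := rfl

/-- The projection of `TM ⊕ φ^! 𝕋 N` to `φ^! 𝕋 N`. -/
def pullbackAmbientSnd (φ : C^∞⟮𝓘(ℝ, E), M; 𝓘(ℝ, E'), N⟯) (x : M) :
    PullbackAmbient φ (GenTangent E') x →ₗ[ℝ] GenTangent E' (φ x) where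
  toFun p := p.2
  map_add' _ _ := rfl
  map_smul' _ _ := rfl

section PullbackFrame

variable [FiniteDimensional ℝ E] [FiniteDimensional ℝ E'] {φ : C^∞⟮𝓘(ℝ, E), M; 𝓘(ℝ, E'), N⟯}
  {K : ∀ y : N, Submodule ℝ (GenTangent E' y)} {hK : CourantClosed K}

/-- A frame `s` of `K` lifts to the pairs `(H s i, s i)`, and the pairs `(Z j, 0)` with `Z` vertical
span the kernel of the projection to `K`. -/
lemma isSmoothSubbundle_pullbackFiber
    (hφ : ∀ x, Function.Surjective (mfderiv 𝓘(ℝ, E) 𝓘(ℝ, E') φ x))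
    (hsub : IsSmoothSubbundle E' (E' × (E' →L[ℝ] ℝ)) K) :
    IsSmoothSubbundle E (E × (E' × (E' →L[ℝ] ℝ))) (pullbackFiber φ (courantAlgebroid K hK)) := by
  intro x₀
  obtain ⟨r, H, Z, hH⟩ := exists_local_splitting φ.contMDiff x₀ (hφ x₀)
  obtain ⟨U, hU, hxU, k, s, hs, hsK⟩ := hsub (φ x₀)
  obtain ⟨O, hO, hOo, hxO⟩ := eventually_nhds_iff.1 hH
  let t : Fin k ⊕ Fin r → ∀ x, PullbackAmbient φ (GenTangent E') x := fun i x =>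
    Sum.elim (fun i => ((H x (s i (φ x)).1, s i (φ x)) : PullbackAmbient φ (GenTangent E') x))
      (fun j => (Z j x, 0)) i
  have htmem : ∀ x ∈ O ∩ φ ⁻¹' U, ∀ i, t i x ∈ pullbackFiber φ (courantAlgebroid K hK) x := by
    rintro x ⟨hx, hxU⟩ (i | j)
    · exact mem_pullbackFiber_iff.2 ⟨(hsK _ hxU).2 ▸ Submodule.subset_span ⟨i, rfl⟩,
        ((hO x hx).1 _).symm⟩
    · refine mem_pullbackFiber_iff.2 ⟨(K (φ x)).zero_mem, ?_⟩
      have : Z j x ∈ (mfderiv 𝓘(ℝ, E) 𝓘(ℝ, E') φ x).toLinearMap.ker :=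
        (hO x hx).2.2.1 ▸ Submodule.subset_span ⟨j, rfl⟩
      exact (LinearMap.mem_ker.1 this).symm
  refine ⟨O ∩ φ ⁻¹' U, hOo.inter (hU.preimage φ.contMDiff.continuous), ⟨hxO, hxU⟩, k + r,
    fun i => t (finSumFinEquiv.symm i), fun i => ?_, fun x hx => ⟨?_, ?_⟩⟩
  · intro x hx
    refine ContMDiffAt.contMDiffWithinAt ?_
    have hb : ∀ i, ContMDiffAt 𝓘(ℝ, E) (𝓘(ℝ, E).prod 𝓘(ℝ, E × (E' × (E' →L[ℝ] ℝ)))) ∞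
        (fun m => TotalSpace.mk' (E × (E' × (E' →L[ℝ] ℝ))) m (t i m)) x := by
      rintro (i | j)
      · refine contMDiffAt_pullbackAmbient_iff.2 ?_
        have h1 : SmoothGen E φ (fun m => s i (φ m)) x :=
          ((hs i).contMDiffAt (hU.mem_nhds hx.2)).comp x (φ.contMDiff x)
        exact ⟨(hO x hx.1).2.2.2.2 _ (smoothGen_iff.1 h1).1, h1⟩
      · refine contMDiffAt_pullbackAmbient_iff.2 ⟨(hO x hx.1).2.2.2.1 j, ?_⟩
        exact (contMDiff_zeroSection ℝ (GenTangent E' : N → Type _) (φ x)).comp x (φ.contMDiff x)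
    exact hb _
  · let p1 := pullbackAmbientFst φ x
    let p2 := pullbackAmbientSnd φ x
    refine LinearIndependent.comp (v := fun i => t i x) ?_ _ finSumFinEquiv.symm.injective
    rw [Fintype.linearIndependent_iff]
    intro c hc
    rw [Fintype.sum_sum_type] at hc
    have h2 : ∑ i, c (Sum.inl i) • s i (φ x) = 0 := by
      have := congrArg p2 hc
      rw [map_add, map_sum, map_sum, map_zero] at this
      have hz : ∑ j, p2 (c (Sum.inr j) • t (Sum.inr j) x) = 0 :=
        Finset.sum_eq_zero fun j _ => by
          have h0 : p2 (t (Sum.inr j) x) = 0 := rfl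
          rw [map_smul, h0, smul_zero]
      rw [hz, add_zero] at this
      rw [← this]
      exact Finset.sum_congr rfl fun i _ => (map_smul p2 (c (Sum.inl i)) (t (Sum.inl i) x)).symm
    have h3 := Fintype.linearIndependent_iff.1 (hsK _ hx.2).1 _ h2
    have h4 : ∑ j, c (Sum.inr j) • Z j x = 0 := by
      have := congrArg p1 hc
      rw [map_add, map_sum, map_sum, map_zero] at this
      have hz : ∑ i, p1 (c (Sum.inl i) • t (Sum.inl i) x) = 0 :=
        Finset.sum_eq_zero fun i _ => by rw [h3 i, zero_smul, map_zero]
      rw [hz, zero_add] at this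
      rw [← this]
      exact Finset.sum_congr rfl fun j _ => (map_smul p1 (c (Sum.inr j)) (t (Sum.inr j) x)).symm
    have h5 := Fintype.linearIndependent_iff.1 (hO x hx.1).2.1 _ h4
    rintro (i | j)
    · exact h3 i
    · exact h5 j
  · let p1 := pullbackAmbientFst φ x
    let p2 := pullbackAmbientSnd φ x
    have hr : Set.range (fun i => t (finSumFinEquiv.symm i) x) = Set.range fun i => t i x :=
      finSumFinEquiv.symm.surjective.range_comp fun i => t i x
    rw [hr]
    refine le_antisymm (Submodule.span_le.2 ?_) ?_
    · rintro _ ⟨i, rfl⟩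
      exact htmem x hx i
    · rintro ⟨X, v⟩ hp
      obtain ⟨h1, h2⟩ := mem_pullbackFiber_iff.1 hp
      rw [← (hsK _ hx.2).2] at h1
      obtain ⟨c, hc⟩ : ∃ c : Fin k → ℝ, ∑ i, c i • s i (φ x) = (v : GenTangent E' (φ x)) :=
        (Submodule.mem_span_range_iff_exists_fun ℝ (M := GenTangent E' (φ x))).1 h1
      -- Subtracting the horizontal lift of the `K`-component leaves a vertical vector, which the
      -- frame `Z` expands.
      have hX : X - ∑ i, c i • H x (s i (φ x)).1 ∈
          (mfderiv 𝓘(ℝ, E) 𝓘(ℝ, E') φ x).toLinearMap.ker := by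
        rw [LinearMap.mem_ker]
        change mfderiv 𝓘(ℝ, E) 𝓘(ℝ, E') φ x (X - ∑ i, c i • H x (s i (φ x)).1) = 0
        rw [map_sub, map_sum, sub_eq_zero]
        simp only [map_smul, (hO x hx.1).1]
        refine h2.symm.trans ?_
        let q : GenTangent E' (φ x) →ₗ[ℝ] TangentSpace 𝓘(ℝ, E') (φ x) := LinearMap.fst ℝ _ _
        have := congrArg q hc
        refine this.symm.trans ((map_sum q _ _).trans ?_)
        exact Finset.sum_congr rfl fun i _ => map_smul q (c i) (s i (φ x))
      rw [← (hO x hx.1).2.2.1] at hX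
      obtain ⟨d, hd⟩ := (Submodule.mem_span_range_iff_exists_fun ℝ).1 hX
      refine (Submodule.mem_span_range_iff_exists_fun ℝ).2 ⟨Sum.elim c d, ?_⟩
      rw [Fintype.sum_sum_type]
      have hsum1 : p1 (∑ i, (Sum.elim c d (Sum.inl i) : ℝ) • t (Sum.inl i) x +
          ∑ j, (Sum.elim c d (Sum.inr j) : ℝ) • t (Sum.inr j) x) = X := by
        rw [map_add, map_sum, map_sum]
        have e1 : ∑ i, p1 ((Sum.elim c d (Sum.inl i) : ℝ) • t (Sum.inl i) x) =
          ∑ i, c i • H x (s i (φ x)).1 := rfl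
        have e2 : ∑ j, p1 ((Sum.elim c d (Sum.inr j) : ℝ) • t (Sum.inr j) x) =
          ∑ j, d j • Z j x := rfl
        rw [e1, e2, hd]
        abel
      have hsum2 : p2 (∑ i, (Sum.elim c d (Sum.inl i) : ℝ) • t (Sum.inl i) x +
          ∑ j, (Sum.elim c d (Sum.inr j) : ℝ) • t (Sum.inr j) x) = v := by
        rw [map_add, map_sum, map_sum]
        have e1 : ∑ i, p2 ((Sum.elim c d (Sum.inl i) : ℝ) • t (Sum.inl i) x) =
          ∑ i, c i • s i (φ x) := rfl
        have e2 : ∑ j, p2 ((Sum.elim c d (Sum.inr j) : ℝ) • t (Sum.inr j) x) = 0 :=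
          Finset.sum_eq_zero fun j _ => by
            have h0 : p2 (t (Sum.inr j) x) = 0 := rfl
            rw [map_smul, h0, smul_zero]
        rw [e1, e2, add_zero]
        exact hc
      exact Prod.ext hsum1 hsum2

lemma isSmoothSubbundle_backwardImage
    (hφ : ∀ x, Function.Surjective (mfderiv 𝓘(ℝ, E) 𝓘(ℝ, E') φ x)) (hK : CourantClosed K)
    (hsub : IsSmoothSubbundle E' (E' × (E' →L[ℝ] ℝ)) K) :
    IsSmoothSubbundle E (E × (E →L[ℝ] ℝ)) (backwardImage (E := E) φ K) := by
  intro x₀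
  obtain ⟨U, hU, hxU, k, s, hs, hsK⟩ := isSmoothSubbundle_pullbackFiber (hK := hK) hφ hsub x₀
  have hmem : ∀ x ∈ U, ∀ i, s i x ∈ pullbackFiber φ (courantAlgebroid K hK) x :=
    fun x hx i => (hsK x hx).2 ▸ Submodule.subset_span ⟨i, rfl⟩
  refine ⟨U, hU, hxU, k, fun i x => pullbackToGen φ x (s i x), fun i x hx => ?_, fun x hx => ⟨?_, ?_⟩⟩
  · refine ContMDiffAt.contMDiffWithinAt ?_
    refine (contMDiffAt_pullbackToGen_iff (hφ x) ?_).1 ((hs i).contMDiffAt (hU.mem_nhds hx))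
    filter_upwards [hU.mem_nhds hx] with m hm
    exact (mem_pullbackFiber_iff.1 (hmem m hm i)).2
  · refine (hsK x hx).1.map ?_
    rw [(hsK x hx).2, Submodule.disjoint_def]
    exact fun p hp h => pullbackToGen_injOn (hφ x) p hp h
  · rw [← map_pullbackToGen (hK := hK), ← (hsK x hx).2, Submodule.map_span, ← Set.range_comp]
    rfl

/-- The isomorphism `X + φ^* β ↦ (X, φ_* X + β)`. -/
def backwardImageEquiv (hφ : ∀ x, Function.Surjective (mfderiv 𝓘(ℝ, E) 𝓘(ℝ, E') φ x))
    (hK : CourantClosed K) (x : M) :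
    backwardImage (E := E) φ K x ≃ₗ[ℝ] pullbackFiber φ (courantAlgebroid K hK) x :=
  (LinearEquiv.ofBijective ((pullbackToGen φ x).restrict
    (p := pullbackFiber φ (courantAlgebroid K hK) x) (q := backwardImage (E := E) φ K x)
    fun p hp => map_pullbackToGen (φ := φ) (hK := hK) x ▸ Submodule.mem_map_of_mem hp)
    ⟨(injective_iff_map_eq_zero _).2 fun p hp => Subtype.ext
      (pullbackToGen_injOn (hφ x) p.1 p.2 (congrArg Subtype.val hp)), fun q => by
      obtain ⟨p, hp, hpq⟩ := (map_pullbackToGen (φ := φ) (hK := hK) x).ge q.2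
      exact ⟨⟨p, hp⟩, Subtype.ext hpq⟩⟩).symm

lemma pullbackToGen_backwardImageEquiv
    (hφ : ∀ x, Function.Surjective (mfderiv 𝓘(ℝ, E) 𝓘(ℝ, E') φ x))
    (hK : CourantClosed K) (x : M) (p : backwardImage (E := E) φ K x) :
    pullbackToGen φ x (backwardImageEquiv hφ hK x p).1 = p.1 :=
  congrArg Subtype.val ((backwardImageEquiv hφ hK x).symm_apply_apply p)

lemma backwardImageEquiv_eq
    (hφ : ∀ x, Function.Surjective (mfderiv 𝓘(ℝ, E) 𝓘(ℝ, E') φ x))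
    (hK : CourantClosed K) (x : M) (p : backwardImage (E := E) φ K x)
    {q : PullbackAmbient φ (GenTangent E') x}
    (hq : q ∈ pullbackFiber φ (courantAlgebroid K hK) x) (h : pullbackToGen φ x q = p.1) :
    (backwardImageEquiv hφ hK x p).1 = q := by
  have : backwardImageEquiv hφ hK x p = ⟨q, hq⟩ :=
    (backwardImageEquiv hφ hK x).symm.injective
      (((backwardImageEquiv hφ hK x).symm_apply_apply p).trans (Subtype.ext h.symm))
  rw [this]

lemma backwardImageEquiv_smooth
    (hφ : ∀ x, Function.Surjective (mfderiv 𝓘(ℝ, E) 𝓘(ℝ, E') φ x))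
    (hK : CourantClosed K) (s : ∀ x, backwardImage (E := E) φ K x) :
    s ∈ SmoothSections E (E × (E →L[ℝ] ℝ)) (backwardImage (E := E) φ K) ↔
      (fun x => backwardImageEquiv hφ hK x (s x)) ∈
        SmoothSections E (E × (E' × (E' →L[ℝ] ℝ))) (pullbackFiber φ (courantAlgebroid K hK)) := by
  refine forall_congr' fun x => ?_
  have := contMDiffAt_pullbackToGen_iff (hφ x) (p := fun m => (backwardImageEquiv hφ hK m (s m)).1)
    (Eventually.of_forall fun m => (mem_pullbackFiber_iff.1 (backwardImageEquiv hφ hK m (s m)).2).2)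
  simp only [pullbackToGen_backwardImageEquiv] at this
  exact this.symm

end PullbackFrame

/-! ### The bracket on the pullback bundle -/

section PullbackAlgebroid

variable [FiniteDimensional ℝ E] [FiniteDimensional ℝ E'] {φ : C^∞⟮𝓘(ℝ, E), M; 𝓘(ℝ, E'), N⟯}
  {K : ∀ y : N, Submodule ℝ (GenTangent E' y)} {hK : CourantClosed K}

lemma pullbackBracket_mem {ι κ : Type*} [Fintype ι] [Fintype κ] (hK : CourantClosed K)
    (f : ι → M → ℝ) (g : κ → M → ℝ)
    (α : ι → SmoothSections E' (E' × (E' →L[ℝ] ℝ)) K)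
    (β : κ → SmoothSections E' (E' × (E' →L[ℝ] ℝ)) K) (x : M) (X Y : TangentSpace 𝓘(ℝ, E) x) :
    pullbackBracket (φ := φ) f g (fun i y => (α i).1 y) (fun j y => (β j).1 y) x X Y ∈ K (φ x) := by
  refine Submodule.sub_mem _ (Submodule.add_mem _ ?_ ?_) ?_
  · refine Submodule.sum_mem _ fun i _ => Submodule.sum_mem _ fun j _ => Submodule.smul_mem _ _ ?_
    rw [← courantAlgebroid_bracket_apply hK]
    exact ((courantAlgebroid K hK).bracket (α i) (β j)).1 (φ x) |>.2
  · exact Submodule.sum_mem _ fun j _ => Submodule.smul_mem _ _ ((β j).1 (φ x)).2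
  · exact Submodule.sum_mem _ fun i _ => Submodule.smul_mem _ _ ((α i).1 (φ x)).2

variable {ι κ : Type*} [Fintype ι] [Fintype κ]

lemma section_components
    (s : SmoothSections E (E × (E' × (E' →L[ℝ] ℝ))) (pullbackFiber φ (courantAlgebroid K hK)))
    (f : ι → M → ℝ) (α : ι → SmoothSections E' (E' × (E' →L[ℝ] ℝ)) K) (y : M)
    (h : (s.1 y).1.2 = ∑ i, f i y • ((α i).1 (φ y) : GenTangent E' (φ y))) :
    mfderiv 𝓘(ℝ, E) 𝓘(ℝ, E') φ y (s.1 y).1.1 =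
        ∑ i, f i y • ((α i).1 (φ y) : GenTangent E' (φ y)).1 ∧
      (pullbackToGen φ y (s.1 y).1).2 =
        ∑ i, f i y • pullbackCovector (E := E) φ y ((α i).1 (φ y) : GenTangent E' (φ y)).2 := by
  let p : GenTangent E' (φ y) →ₗ[ℝ] TangentSpace 𝓘(ℝ, E') (φ y) := LinearMap.fst ℝ _ _
  let q : GenTangent E' (φ y) →ₗ[ℝ] Cotangent E y :=
    { toFun := fun v => pullbackCovector (E := E) φ y v.2
      map_add' := fun _ _ => rfl
      map_smul' := fun _ _ => rfl }
  constructor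
  · refine (mem_pullbackFiber_iff.1 (s.1 y).2).2.symm.trans ((congrArg p h).trans ?_)
    exact (map_sum p _ _).trans (Finset.sum_congr rfl fun i _ => map_smul p (f i y) _)
  · refine (congrArg q h).trans ?_
    exact (map_sum q _ _).trans (Finset.sum_congr rfl fun i _ => map_smul q (f i y) _)

/-- The prescribed formula gives an element of `φ^{!!}K` that corresponds to the Courant bracket.
This serves twice: for the closedness of the backward image and for the formula of the transported
bracket. -/
lemma courantBracket_pullbackToGen (hiso : ∀ y, IsIsotropic (K y))
    {s t : SmoothSections E (E × (E' × (E' →L[ℝ] ℝ))) (pullbackFiber φ (courantAlgebroid K hK))}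
    {f : ι → M → ℝ} {g : κ → M → ℝ}
    {α : ι → SmoothSections E' (E' × (E' →L[ℝ] ℝ)) K}
    {β : κ → SmoothSections E' (E' × (E' →L[ℝ] ℝ)) K} {x : M}
    (hφx : Function.Surjective (mfderiv 𝓘(ℝ, E) 𝓘(ℝ, E') φ x))
    (hf : ∀ i, SmoothFun E (f i) x) (hg : ∀ j, SmoothFun E (g j) x)
    (hs : ∀ᶠ y in 𝓝 x, (s.1 y).1.2 = ∑ i, f i y • ((α i).1 (φ y) : GenTangent E' (φ y)))
    (ht : ∀ᶠ y in 𝓝 x, (t.1 y).1.2 = ∑ j, g j y • ((β j).1 (φ y) : GenTangent E' (φ y))) :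
    ((courantBracket (fun y => pullbackToGen φ y (s.1 y).1)
        (fun y => pullbackToGen φ y (t.1 y).1) x).1,
      pullbackBracket (φ := φ) f g (fun i y => (α i).1 y) (fun j y => (β j).1 y) x
        (s.1 x).1.1 (t.1 x).1.1) ∈ pullbackFiber φ (courantAlgebroid K hK) x ∧
    pullbackToGen φ x ((courantBracket (fun y => pullbackToGen φ y (s.1 y).1)
        (fun y => pullbackToGen φ y (t.1 y).1) x).1,
      pullbackBracket (φ := φ) f g (fun i y => (α i).1 y) (fun j y => (β j).1 y) x
        (s.1 x).1.1 (t.1 x).1.1) = courantBracket (fun y => pullbackToGen φ y (s.1 y).1)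
          (fun y => pullbackToGen φ y (t.1 y).1) x := by
  have hsm : ∀ (s : SmoothSections E (E × (E' × (E' →L[ℝ] ℝ)))
      (pullbackFiber φ (courantAlgebroid K hK))),
      SmoothGen E id (fun y => pullbackToGen φ y (s.1 y).1) x := fun s =>
    (contMDiffAt_pullbackToGen_iff hφx
      (Eventually.of_forall fun m => (mem_pullbackFiber_iff.1 (s.1 m).2).2)).1 (s.2 x)
  have hmem : ∀ (s : SmoothSections E (E × (E' × (E' →L[ℝ] ℝ)))
      (pullbackFiber φ (courantAlgebroid K hK))) (y : M),
      pullbackToGen φ y (s.1 y).1 ∈ backwardImage (E := E) φ K y := fun s y =>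
    map_pullbackToGen (φ := φ) (hK := hK) y ▸ Submodule.mem_map_of_mem (s.1 y).2
  obtain ⟨h1, h2⟩ := courantBracket_pullback (φ := φ) (x := x) φ.contMDiff (hsm s) (hsm t) hf hg
    (fun i => smoothGen_section (α i) (φ x)) (fun j => smoothGen_section (β j) (φ x))
    (fun i j => Eventually.of_forall fun y => hiso y _ ((α i).1 y).2 _ ((β j).1 y).2)
    (Eventually.of_forall fun y => isIsotropic_backwardImage (hiso (φ y)) _ (hmem s y) _ (hmem t y))
    (hs.mono fun y hy => (section_components s f α y hy).1) (hs.mono fun y hy => (section_components s f α y hy).2)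
    (ht.mono fun y hy => (section_components t g β y hy).1) (ht.mono fun y hy => (section_components t g β y hy).2)
  exact ⟨mem_pullbackFiber_iff.2 ⟨pullbackBracket_mem hK f g α β x _ _, h1.symm⟩,
    Prod.ext rfl h2.symm⟩

variable [T2Space M] [T2Space N]

lemma exists_pullback_representation (hsub : IsSmoothSubbundle E' (E' × (E' →L[ℝ] ℝ)) K)
    (s : SmoothSections E (E × (E' × (E' →L[ℝ] ℝ))) (pullbackFiber φ (courantAlgebroid K hK)))
    (x : M) : ∃ (r : ℕ) (f : Fin r → M → ℝ) (α : Fin r → SmoothSections E' (E' × (E' →L[ℝ] ℝ)) K),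
      (∀ i, ContMDiff 𝓘(ℝ, E) 𝓘(ℝ, ℝ) ∞ (f i)) ∧
      ∀ᶠ m in 𝓝 x, (s.1 m).1.2 = ∑ i, f i m • ((α i).1 (φ m) : GenTangent E' (φ m)) :=
  exists_local_representation (v := fun m => (s.1 m).1.2) hsub φ.contMDiff
    (fun m => (contMDiffAt_pullbackAmbient_iff.1 (s.2 m)).2)
    (fun m => (mem_pullbackFiber_iff.1 (s.1 m).2).1) x

/-- Membership is a pointwise question, so representations near each point suffice. -/
lemma courantClosed_backwardImage
    (hφ : ∀ x, Function.Surjective (mfderiv 𝓘(ℝ, E) 𝓘(ℝ, E') φ x))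
    (hK : CourantClosed K) (hsub : IsSmoothSubbundle E' (E' × (E' →L[ℝ] ℝ)) K)
    (hiso : ∀ y, IsIsotropic (K y)) : CourantClosed (backwardImage (E := E) φ K) := by
  intro s t
  let Φ := SmoothSections.mapEquiv _ (backwardImageEquiv_smooth hφ hK)
  have hΦ : ∀ (s : SmoothSections E (E × (E →L[ℝ] ℝ)) (backwardImage (E := E) φ K)) (y : M),
      pullbackToGen φ y ((Φ s).1 y).1 = (s.1 y).1 :=
    fun s y => pullbackToGen_backwardImageEquiv hφ hK y (s.1 y)
  refine ⟨⟨fun x => ⟨courantBracket (fun y => (s.1 y : GenTangent E y))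
    (fun y => (t.1 y : GenTangent E y)) x, ?_⟩, ?_⟩, fun x => rfl⟩
  · obtain ⟨k, f, α, hf, hs⟩ := exists_pullback_representation hsub (Φ s) x
    obtain ⟨l, g, β, hg, ht⟩ := exists_pullback_representation hsub (Φ t) x
    obtain ⟨h1, h2⟩ := courantBracket_pullbackToGen hiso (hφ x) (fun i => hf i x)
      (fun j => hg j x) hs ht
    simp only [hΦ] at h1 h2
    rw [← h2, ← map_pullbackToGen (hK := hK)]
    exact Submodule.mem_map_of_mem h1
  · exact smoothGen_courantBracket (fun x => smoothGen_section s x) (fun x => smoothGen_section t x)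
      fun y => isIsotropic_backwardImage (hiso (φ y)) _ (s.1 y).2 _ (t.1 y).2

/-- The anchor and bracket on `φ^{!!} K` transported from the backward image. -/
def pullbackCourantAlgebroid (hφ : ∀ x, Function.Surjective (mfderiv 𝓘(ℝ, E) 𝓘(ℝ, E') φ x))
    (hK : CourantClosed K) (hB : CourantClosed (backwardImage (E := E) φ K)) :
    AlgebroidData E (E × (E' × (E' →L[ℝ] ℝ))) (pullbackFiber φ (courantAlgebroid K hK)) where
  anchor x := (pullbackAmbientFst φ x).comp (Submodule.subtype _)
  bracket s t :=
    let Φ := SmoothSections.mapEquiv _ (backwardImageEquiv_smooth hφ hK)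
    Φ ((courantAlgebroid _ hB).bracket (Φ.symm s) (Φ.symm t))

lemma isLieAlgebroidIso_pullbackCourantAlgebroid
    (hφ : ∀ x, Function.Surjective (mfderiv 𝓘(ℝ, E) 𝓘(ℝ, E') φ x))
    (hK : CourantClosed K) (hB : CourantClosed (backwardImage (E := E) φ K)) :
    IsLieAlgebroidIso (courantAlgebroid _ hB) (pullbackCourantAlgebroid hφ hK hB)
      (backwardImageEquiv hφ hK) where
  smooth := backwardImageEquiv_smooth hφ hK
  anchor x v := congrArg Prod.fst (pullbackToGen_backwardImageEquiv hφ hK x v)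
  bracket s t s' t' hs ht x := by
    let Φ := SmoothSections.mapEquiv _ (backwardImageEquiv_smooth hφ hK)
    obtain rfl : s' = Φ s := Subtype.ext (funext hs)
    obtain rfl : t' = Φ t := Subtype.ext (funext ht)
    change (Φ ((courantAlgebroid _ hB).bracket (Φ.symm (Φ s)) (Φ.symm (Φ t)))).1 x = _
    rw [Φ.symm_apply_apply, Φ.symm_apply_apply]
    rfl

/-- The transported bracket refers to no representation, so the formula holds for all of them and
its value is independent of the choice. -/
lemma isPullbackAlgebroid_pullbackCourantAlgebroid
    (hφ : ∀ x, Function.Surjective (mfderiv 𝓘(ℝ, E) 𝓘(ℝ, E') φ x))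
    (hK : CourantClosed K) (hB : CourantClosed (backwardImage (E := E) φ K))
    (hiso : ∀ y, IsIsotropic (K y)) :
    IsPullbackAlgebroid φ (courantAlgebroid K hK) (pullbackCourantAlgebroid hφ hK hB) where
  anchor _ _ := rfl
  bracket s t k l f α g β hf hg x hs ht := by
    let Φ := SmoothSections.mapEquiv _ (backwardImageEquiv_smooth hφ hK)
    have hΦ : ∀ s y, ((Φ.symm s).1 y).1 = pullbackToGen φ y (s.1 y).1 := fun s y => rfl
    obtain ⟨h1, h2⟩ := courantBracket_pullbackToGen hiso (hφ x) (fun i => hf i x)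
      (fun j => hg j x) hs ht
    have h3 : (((pullbackCourantAlgebroid hφ hK hB).bracket s t).1 x).1 = _ :=
      backwardImageEquiv_eq hφ hK x (((courantAlgebroid _ hB).bracket (Φ.symm s) (Φ.symm t)).1 x) h1
        (h2.trans (courantAlgebroid_bracket_apply hB (Φ.symm s) (Φ.symm t) x).symm)
    rw [h3]
    refine ⟨rfl, ?_⟩
    simp only [courantAlgebroid_bracket_apply]
    rfl

lemma IsPullbackAlgebroid.unique (hsub : IsSmoothSubbundle E' (E' × (E' →L[ℝ] ℝ)) K)
    {P Q : AlgebroidData E (E × (E' × (E' →L[ℝ] ℝ))) (pullbackFiber φ (courantAlgebroid K hK))}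
    (hP : IsPullbackAlgebroid φ (courantAlgebroid K hK) P)
    (hQ : IsPullbackAlgebroid φ (courantAlgebroid K hK) Q) : P = Q := by
  refine AlgebroidData.ext (funext fun x => LinearMap.ext fun p => ?_)
    (funext fun s => funext fun t => Subtype.ext (funext fun x => Subtype.ext ?_))
  · rw [hP.anchor, hQ.anchor]
  · obtain ⟨k, f, α, hf, hs⟩ := exists_pullback_representation hsub s x
    obtain ⟨l, g, β, hg, ht⟩ := exists_pullback_representation hsub t x
    obtain ⟨h1, h2⟩ := hP.bracket s t k l f α g β hf hg x hs ht
    obtain ⟨h3, h4⟩ := hQ.bracket s t k l f α g β hf hg x hs ht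
    exact Prod.ext (h1.trans h3.symm) (h2.trans h4.symm)

end PullbackAlgebroid

/-! ### Forward Dirac maps and the main theorem -/

lemma IsBackwardDirac.isForwardDirac {φ : M → N} {L : ∀ x : M, Submodule ℝ (GenTangent E x)}
    {K : ∀ y : N, Submodule ℝ (GenTangent E' y)} (h : IsBackwardDirac φ L K)
    (hφ : ∀ x, Function.Surjective (mfderiv 𝓘(ℝ, E) 𝓘(ℝ, E') φ x)) : IsForwardDirac φ L K := by
  intro x
  ext q
  constructor
  · intro hq
    obtain ⟨X, hX⟩ := hφ x q.1
    have hq' : q = (mfderiv 𝓘(ℝ, E) 𝓘(ℝ, E') φ x X, q.2) := Prod.ext hX.symm rfl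
    refine ⟨X, q.2, hq', ?_⟩
    rw [h x]
    exact ⟨q.2, rfl, hq' ▸ hq⟩
  · rintro ⟨X, α, rfl, hα⟩
    rw [h x] at hα
    obtain ⟨β, hβ, hK⟩ := hα
    obtain rfl : α = β := pullbackCovector_injective (hφ x) hβ
    exact hK

end

theorem mainTheorem4
    {E : Type*} [NormedAddCommGroup E] [NormedSpace ℝ E] [FiniteDimensional ℝ E]
    {M : Type*} [TopologicalSpace M] [ChartedSpace E M] [IsManifold 𝓘(ℝ, E) ∞ M]
    [T2Space M] [SigmaCompactSpace M]
    {E' : Type*} [NormedAddCommGroup E'] [NormedSpace ℝ E'] [FiniteDimensional ℝ E']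
    {N : Type*} [TopologicalSpace N] [ChartedSpace E' N] [IsManifold 𝓘(ℝ, E') ∞ N]
    [T2Space N] [SigmaCompactSpace N]
    (φ : C^∞⟮𝓘(ℝ, E), M; 𝓘(ℝ, E'), N⟯)
    (hφ : ∀ x, Function.Surjective (mfderiv 𝓘(ℝ, E) 𝓘(ℝ, E') φ x))
    (K : DiracStructure E' N) :
    -- the pullback Lie algebroid `φ^{!!} K` is well defined
    (∃! P : AlgebroidData E (E × (E' × (E' →L[ℝ] ℝ))) (pullbackFiber φ K.algebroid),
      IsPullbackAlgebroid φ K.algebroid P) ∧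
    (∀ P : AlgebroidData E (E × (E' × (E' →L[ℝ] ℝ))) (pullbackFiber φ K.algebroid),
      IsPullbackAlgebroid φ K.algebroid P → IsLieAlgebroid P) ∧
    -- the backward image is a Lie algebroid, isomorphic to `φ^{!!} K`
    (∃ hB : CourantClosed (backwardImage (E := E) φ K.fiber),
      IsLieAlgebroid (courantAlgebroid (backwardImage (E := E) φ K.fiber) hB) ∧
      ∀ P : AlgebroidData E (E × (E' × (E' →L[ℝ] ℝ))) (pullbackFiber φ K.algebroid),
        IsPullbackAlgebroid φ K.algebroid P →
        ∃ ψ : ∀ x, backwardImage φ K.fiber x ≃ₗ[ℝ] pullbackFiber φ K.algebroid x,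
          (∀ x (X : TangentSpace 𝓘(ℝ, E) x) (β : Cotangent E' (φ x))
            (h : ((X, pullbackCovector φ x β) : GenTangent E x) ∈ backwardImage φ K.fiber x),
            (ψ x ⟨(X, pullbackCovector φ x β), h⟩ : PullbackAmbient φ (GenTangent E') x) =
              (X, (mfderiv 𝓘(ℝ, E) 𝓘(ℝ, E') φ x X, β))) ∧
          IsLieAlgebroidIso (courantAlgebroid (backwardImage (E := E) φ K.fiber) hB) P ψ) ∧
    -- submersive backward Dirac maps
    (∀ L : DiracStructure E M, IsBackwardDirac φ L.fiber K.fiber →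
      IsForwardDirac φ L.fiber K.fiber ∧
      IsLieAlgebroid L.algebroid ∧
      ∀ P : AlgebroidData E (E × (E' × (E' →L[ℝ] ℝ))) (pullbackFiber φ K.algebroid),
        IsPullbackAlgebroid φ K.algebroid P →
        ∃ ψ : ∀ x, L.fiber x ≃ₗ[ℝ] pullbackFiber φ K.algebroid x,
          IsLieAlgebroidIso L.algebroid P ψ) := by

  have hiso : ∀ y, IsIsotropic (K.fiber y) := fun y => (K.maximal_isotropic y).prop
  have hB := courantClosed_backwardImage hφ K.integrable K.subbundle hiso
  have hLie := isLieAlgebroid_courantAlgebroid hB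
    (isSmoothSubbundle_backwardImage hφ K.integrable K.subbundle)
    fun x => isIsotropic_backwardImage (hiso (φ x))
  have hP₀ := isPullbackAlgebroid_pullbackCourantAlgebroid hφ K.integrable hB hiso
  have hψ := isLieAlgebroidIso_pullbackCourantAlgebroid hφ K.integrable hB
  -- Every structure satisfying the formula is the transported one, so all claims need checking for
  -- that one only.
  have huniq : ∀ P, IsPullbackAlgebroid φ K.algebroid P →
      P = pullbackCourantAlgebroid hφ K.integrable hB :=
    fun P hP => IsPullbackAlgebroid.unique K.subbundle hP hP₀
  refine ⟨⟨_, hP₀, huniq⟩, fun P hP => ?_, ⟨hB, hLie, fun P hP => ?_⟩, fun L hL => ?_⟩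
  · rw [huniq P hP]
    exact hψ.isLieAlgebroid hLie (isSmoothSubbundle_pullbackFiber hφ K.subbundle)
  · rw [huniq P hP]
    refine ⟨backwardImageEquiv hφ K.integrable, fun x X β h => ?_, hψ⟩
    refine backwardImageEquiv_eq hφ K.integrable x _ (mem_pullbackFiber_iff.2 ⟨?_, rfl⟩) rfl
    -- Membership only provides some `γ` with `φ^*γ = φ^*β`; injectivity of `φ^*` identifies it with
    -- `β`.
    obtain ⟨γ, hγ, hmem⟩ := h
    obtain rfl : β = γ := pullbackCovector_injective (hφ x) hγ
    exact hmem
  · refine ⟨hL.isForwardDirac hφ, isLieAlgebroid_courantAlgebroid L.integrable L.subbundle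
      fun x => (L.maximal_isotropic x).prop, fun P hP => ?_⟩
    rw [huniq P hP]
    -- Stated for a variable family `L`, so that the equality with the backward image can be
    -- substituted in the types and in the closedness proof.
    have key : ∀ (L : ∀ x : M, Submodule ℝ (GenTangent E x)) (hLc : CourantClosed L),
        L = backwardImage (E := E) φ K.fiber →
        ∃ ψ : ∀ x, L x ≃ₗ[ℝ] pullbackFiber φ K.algebroid x,
          IsLieAlgebroidIso (courantAlgebroid L hLc)
            (pullbackCourantAlgebroid hφ K.integrable hB) ψ := by
      rintro _ hLc rfl
      exact ⟨_, hψ⟩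
    exact key L.fiber L.integrable (funext hL)
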